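/- Let $\mathbb H$ be the algebra of real quaternions, $\mathbb S=\{q\in\mathbb H:\ q^2=-1\}$, and for $I\in\mathbb S$ let $\mathbb C_I=\mathbb R+\mathbb R I$ with $d\lambda_I(q)=dx\,dy$ for $q=x+yI$. A function $f:\mathbb H\to\mathbb H$ is slice regular if it is real differentiable and, for every $J\in\mathbb S$, its restriction $(x,y)\mapsto f(x+yJ)$ is $C^1$ and satisfies $\frac12\left(\frac{\partial}{\partial x}+J\frac{\partial}{\partial y}\right)f(x+yJ)=0$. Let $\nu>0$ and $I\in\mathbb S$. Let $\mathcal F^{2,\nu}_{slice}(\mathbb H)$ be the right $\mathbb H$-vector space of slice regular $f:\mathbb H\to\mathbb H$ with $\int_{\mathbb C_I}|f(q)|^2e^{-\nu|q|^2}d\lambda_I(q)<\infty$, with inner product $\langle f,g\rangle=\int_{\mathbb C_I}\overline{g(q)}f(q)e^{-\nu|q|^2}d\lambda_I(q)$. Let $L^2(\mathbb R)=L^2(\mathbb R;\mathbb H)$ be the right $\mathbb H$-vector space with inner product $\langle\varphi,\psi\rangle=\int_{\mathbb R}\overline{\psi(x)}\varphi(x)\,dx$, and for $\psi\in L^2(\mathbb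 R)$ and $q\in\mathbb H$ put $$\mathcal B_\nu(\psi)(q)=\left(\frac{\nu}{\pi}\right)^{3/4}\int_{\mathbb R}e^{-\frac{\nu}{2}(q^2+x^2)+\nu\sqrt2\,qx}\,\psi(x)\,dx .$$ Theorem. The integral defining $\mathcal B_\nu(\psi)(q)$ converges absolutely for all $\psi\in L^2(\mathbb R)$ and $q\in\mathbb H$, and $\mathcal B_\nu$ is a bijection from $L^2(\mathbb R)$ onto $\mathcal F^{2,\nu}_{slice}(\mathbb H)$. Its inverse $[\mathcal B_\nu]^{-1}$ is right $\mathbb H$-linear and unitary (it preserves the inner products, hence the norms) from $\mathcal F^{2,\nu}_{slice}(\mathbb H)$ onto $L^2(\mathbb R)$, and it is given by the integral representation $$[\mathcal B_\nu]^{-1}(f)(x)=\left(\frac{\nu}{\pi}\right)^{3/4}\int_{\mathbb C_I}e^{-\frac{\nu}{2}(\overline q^2+x^2)+\nu\sqrt2\,\overline q x}f(q)\,e^{-\nu|q|^2}\,d\lambda_I(q),$$ where for general $f\in\mathcal F^{2,\nu}_{slice}(\mathbb H)$ the integral is taken in the mean: for every $R$ the same integral over $\{q\in\mathbb C_I:\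 |q|<R\}$ converges absolutely for all $x\in\mathbb R$ and defines a function of $x$ in $L^2(\mathbb R)$, and as $R\to\infty$ these functions converge to $[\mathcal B_\nu]^{-1}(f)$ in the norm of $L^2(\mathbb R)$. For every $f$, the formula also holds literally at almost every $x$ at which the integral over $\mathbb C_I$ converges absolutely; and it converges absolutely at every $x\in\mathbb R$ if $|f(q)|\le Ce^{a|q|^2}$ on $\mathbb C_I$ for some real $C$ and some $a<\nu/2$ (in particular if $f$ is a polynomial $\sum_{n\le N}q^na_n$). -/

import Mathlib

open MeasureTheory Filter Topology
open scoped Quaternion MulOpposite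

noncomputable section

namespace SegalBargmann

/-- The parametrization `x + iy ↦ x + yI` of the slice `ℂ_I = ℝ + ℝI`; it carries Lebesgue measure
`dx dy` on `ℂ` to `dλ_I`. -/
def sliceMap (I : ℍ) (z : ℂ) : ℍ := (z.re : ℍ) + (z.im : ℍ) * I

/-- Slice (left) regular functions on the whole of `ℍ`: real differentiable, and for every imaginary
unit `I` the restriction to `ℂ_I` is `C¹` and satisfies `(1/2) (∂/∂x + I ∂/∂y) f(x + yI) = 0`. -/
structure SliceRegular (f : ℍ → ℍ) : Prop where
  differentiable : Differentiable ℝ f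
  contDiff_slice : ∀ I : ℍ, I ^ 2 = -1 → ContDiff ℝ 1 (fun z : ℂ => f (sliceMap I z))
  dbar_eq_zero : ∀ I : ℍ, I ^ 2 = -1 → ∀ x y : ℝ,
    (1 / 2 : ℝ) • (deriv (fun s : ℝ => f (sliceMap I ⟨s, y⟩)) x
      + I * deriv (fun t : ℝ => f (sliceMap I ⟨x, t⟩)) y) = 0

/-- The squared modulus on `ℂ_I` against the Gaussian weight `e^{-ν|q|²}`. -/
def fockDensity (ν : ℝ) (I : ℍ) (f : ℍ → ℍ) (z : ℂ) : ℝ :=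
  ‖f (sliceMap I z)‖ ^ 2 * Real.exp (-ν * ‖sliceMap I z‖ ^ 2)

lemma continuous_sliceMap (I : ℍ) : Continuous (sliceMap I) := by
  unfold sliceMap
  exact (Quaternion.continuous_coe.comp Complex.continuous_re).add
    ((Quaternion.continuous_coe.comp Complex.continuous_im).mul continuous_const)

lemma SliceRegular.diff_x {f : ℍ → ℍ} (hf : SliceRegular f) {I : ℍ} (x y : ℝ) :
    DifferentiableAt ℝ (fun s : ℝ => f (sliceMap I ⟨s, y⟩)) x := by
  have h : DifferentiableAt ℝ (fun s : ℝ => sliceMap I ⟨s, y⟩) x := by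
    have : (fun s : ℝ => sliceMap I ⟨s, y⟩) = fun s : ℝ => s • (1 : ℍ) + (y : ℍ) * I := by
      funext s; simp [sliceMap, Algebra.smul_def]
    rw [this]; fun_prop
  exact (hf.differentiable _).comp x h

lemma SliceRegular.diff_y {f : ℍ → ℍ} (hf : SliceRegular f) {I : ℍ} (x y : ℝ) :
    DifferentiableAt ℝ (fun t : ℝ => f (sliceMap I ⟨x, t⟩)) y := by
  have h : DifferentiableAt ℝ (fun t : ℝ => sliceMap I ⟨x, t⟩) y := by
    have : (fun t : ℝ => sliceMap I ⟨x, t⟩) = fun t : ℝ => (x : ℍ) + t • I := by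
      funext s; simp [sliceMap, Quaternion.coe_mul_eq_smul]
    rw [this]; fun_prop
  exact (hf.differentiable _).comp y h

lemma SliceRegular.zero : SliceRegular (0 : ℍ → ℍ) where
  differentiable := differentiable_const 0
  contDiff_slice _ _ := contDiff_const
  dbar_eq_zero I _ x y := by simp

lemma SliceRegular.add {f g : ℍ → ℍ} (hf : SliceRegular f) (hg : SliceRegular g) :
    SliceRegular (f + g) where
  differentiable := hf.differentiable.add hg.differentiable
  contDiff_slice I hI := (hf.contDiff_slice I hI).add (hg.contDiff_slice I hI)
  dbar_eq_zero I hI x y := by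
    have h1 := hf.dbar_eq_zero I hI x y
    have h2 := hg.dbar_eq_zero I hI x y
    simp only [Pi.add_apply]
    rw [deriv_fun_add (hf.diff_x x y) (hg.diff_x x y),
      deriv_fun_add (hf.diff_y x y) (hg.diff_y x y), mul_add, add_add_add_comm, smul_add, h1, h2,
      add_zero]

lemma SliceRegular.smul {f : ℍ → ℍ} (c : ℍᵐᵒᵖ) (hf : SliceRegular f) :
    SliceRegular (c • f) where
  differentiable := by
    have : c • f = fun q => f q * c.unop := by funext q; simp
    rw [this]; exact hf.differentiable.mul_const _
  contDiff_slice I hI := by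
    have : (fun z : ℂ => (c • f) (sliceMap I z)) = fun z => f (sliceMap I z) * c.unop := by
      funext q; simp
    rw [this]; exact (hf.contDiff_slice I hI).mul contDiff_const
  dbar_eq_zero I hI x y := by
    have h1 := hf.dbar_eq_zero I hI x y
    simp only [Pi.smul_apply, MulOpposite.smul_eq_mul_unop]
    rw [deriv_mul_const (hf.diff_x x y), deriv_mul_const (hf.diff_y x y), ← mul_assoc, ← add_mul,
      ← smul_mul_assoc, h1, zero_mul]

lemma SliceRegular.continuous_density {f : ℍ → ℍ} (hf : SliceRegular f) (ν : ℝ) (I : ℍ) :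
    Continuous (fockDensity ν I f) := by
  have h1 : Continuous fun z => f (sliceMap I z) :=
    hf.differentiable.continuous.comp (continuous_sliceMap I)
  have h2 := continuous_sliceMap I
  exact (h1.norm.pow 2).mul (Real.continuous_exp.comp (continuous_const.mul (h2.norm.pow 2)))

/-- The slice hyperholomorphic Bargmann-Fock space `F^{2,ν}_I(ℍ)`, a right `ℍ`-vector space. -/
def fock (ν : ℝ) (I : ℍ) : Submodule ℍᵐᵒᵖ (ℍ → ℍ) where
  carrier := {f | SliceRegular f ∧ Integrable (fockDensity ν I f)}
  zero_mem' := ⟨SliceRegular.zero, by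
    have : fockDensity ν I 0 = 0 := by funext z; simp [fockDensity]
    rw [this]; exact integrable_zero _ _ _⟩
  add_mem' := by
    rintro f g ⟨hf, hf'⟩ ⟨hg, hg'⟩
    refine ⟨hf.add hg, ((hf'.add hg').const_mul 2).mono'
      ((hf.add hg).continuous_density ν I).aestronglyMeasurable (ae_of_all _ fun z => ?_)⟩
    have hE := Real.exp_pos (-ν * ‖sliceMap I z‖ ^ 2)
    have h1 := norm_add_le (f (sliceMap I z)) (g (sliceMap I z))
    have h2 := norm_nonneg (f (sliceMap I z) + g (sliceMap I z))
    have h3 : ‖f (sliceMap I z) + g (sliceMap I z)‖ ^ 2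
        ≤ 2 * (‖f (sliceMap I z)‖ ^ 2 + ‖g (sliceMap I z)‖ ^ 2) := by
      nlinarith [sq_nonneg (‖f (sliceMap I z)‖ - ‖g (sliceMap I z)‖)]
    simp only [fockDensity, Pi.add_apply]
    rw [Real.norm_of_nonneg (by positivity), ← add_mul, ← mul_assoc]
    exact mul_le_mul_of_nonneg_right h3 hE.le
  smul_mem' := by
    rintro c f ⟨hf, hf'⟩
    refine ⟨hf.smul c, ?_⟩
    have : fockDensity ν I (c • f) = fun z => ‖c.unop‖ ^ 2 * fockDensity ν I f z := by
      funext z; simp [fockDensity]; ring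
    rw [this]; exact hf'.const_mul _

/-- `⟨f, g⟩ = ∫_{ℂ_I} conj(g(q)) f(q) e^{-ν|q|²} dλ_I(q)`. -/
def fockInner (ν : ℝ) (I : ℍ) (f g : ℍ → ℍ) : ℍ :=
  ∫ z : ℂ, Real.exp (-ν * ‖sliceMap I z‖ ^ 2) • (star (g (sliceMap I z)) * f (sliceMap I z))

/-- `L²(ℝ; ℍ)`; a right `ℍ`-vector space through Mathlib's `ℍᵐᵒᵖ`-module structure. -/
abbrev L2 : Type := Lp ℍ 2 (volume : Measure ℝ)

/-- `⟨φ, ψ⟩ = ∫_ℝ conj(ψ(x)) φ(x) dx`. -/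
def l2Inner (φ ψ : L2) : ℍ := ∫ x : ℝ, star (ψ x) * φ x

/-- `A(q; x) = (ν/π)^{3/4} exp(-(ν/2)(q² + x²) + ν √2 q x)`. -/
def kernel (ν : ℝ) (q : ℍ) (x : ℝ) : ℍ :=
  (ν / Real.pi) ^ (3 / 4 : ℝ) •
    NormedSpace.exp (-(ν / 2) • (q ^ 2 + (x : ℍ) ^ 2) + (ν * √2) • (q * (x : ℍ)))

/-- The quaternionic Segal-Bargmann transform. -/
def transform (ν : ℝ) (ψ : ℝ → ℍ) (q : ℍ) : ℍ := ∫ x : ℝ, kernel ν q x * ψ x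

/-- The integrand, at the point `q = sliceMap I z` of `ℂ_I`, of the inversion integral without its
constant: `exp(-(ν/2)(q̄² + x²) + ν √2 q̄ x) f(q) e^{-ν|q|²}`. -/
def inverseIntegrand (ν : ℝ) (I : ℍ) (f : ℍ → ℍ) (x : ℝ) (z : ℂ) : ℍ :=
  Real.exp (-ν * ‖sliceMap I z‖ ^ 2) •
    (NormedSpace.exp (-(ν / 2) • (star (sliceMap I z) ^ 2 + (x : ℍ) ^ 2)
        + (ν * √2) • (star (sliceMap I z) * (x : ℍ)))
      * f (sliceMap I z))

/-- The inversion integral over a part `s` of the slice. -/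
def inverseIntegral (ν : ℝ) (I : ℍ) (s : Set ℂ) (f : ℍ → ℍ) (x : ℝ) : ℍ :=
  (ν / Real.pi) ^ (3 / 4 : ℝ) • ∫ z in s, inverseIntegrand ν I f x z

end SegalBargmann

end

/-! On a slice `ℂ_J` the kernel is the image of the complex Segal-Bargmann kernel under the algebra
embedding `i ↦ J` (`kernel_sliceMap`). The maps `q ↦ sliceCoord J (q * e)`, for `e` among `1, i, j,
k`, are left `ℂ_J`-linear, together recover `q`, and have squared moduli summing to `2‖q‖²`. Through
them, slice regularity and the norm identity reduce to the case of complex-valued `ψ`.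

For complex `ψ` and fixed `Re z`, the transform is, up to a factor, the Fourier integral in `Im z`
of `ψ` times a Gaussian. Plancherel in `Im z`, followed by a Gaussian integration in `Re z`, gives
the isometry (`lintegral_norm_transformC_sq`).

For surjectivity, let `B` be the resulting isometry into `L²(ℂ; ℍ)`, regarded as a real Hilbert
space. For `f` in the Fock space, `f - B B* f` is orthogonal to the range of `B`. That range
contains the transforms `(ν/π) exp(ν z w̄) e` of `x ↦ A(w̄; x) e`, which are multiples of the
reproducing kernel, so a Fock function orthogonal to the range vanishes on `ℂ_I`
(`eq_zero_of_adjoint_eq_zero`). It then vanishes everywhere, since all slices share the real axis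
(`SliceRegular.eq_zero`).

Hence the inverse is `B*` restricted to the Fock space. Fubini on a disc identifies `B*` of a
truncated function with the inversion integral (`toLp_integral_dualIntegrand`). Since `B*` is a
contraction, letting the radius grow gives convergence in the mean, and a subsequence of radii gives
the pointwise formula. The quaternionic inner product is recovered from the real one by testing
against right multiples. -/

noncomputable section

namespace SegalBargmann

/-! ### Plancherel's theorem for Fourier integrals -/

section Plancherel

open FourierTransform SchwartzMap

open scoped ContDiff in
/-- The `L²` Fourier transform of an integrable function is given by the Fourier integral. -/
theorem Lp_fourier_toLp_ae_eq {g : ℝ → ℂ} (h1 : Integrable g) (h2 : MemLp g 2) :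
    (𝓕 (h2.toLp g) : Lp (α := ℝ) ℂ 2) =ᵐ[volume] 𝓕 g := by
  have hcont : Continuous (𝓕 g) :=
    VectorFourier.fourierIntegral_continuous Real.continuous_fourierChar
      (L := innerₗ ℝ) continuous_inner h1
  refine ae_eq_of_integral_contDiff_smul_eq
    ((Lp.memLp _).locallyIntegrable (by norm_num)) hcont.locallyIntegrable fun φ hφ hc => ?_
  have hg₁ : HasCompactSupport (Complex.ofRealCLM ∘ φ) := hc.comp_left rfl
  have hg₂ : ContDiff ℝ ∞ (Complex.ofRealCLM ∘ φ) := by fun_prop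
  set Φ : 𝓢(ℝ, ℂ) := hg₁.toSchwartzMap hg₂ with hΦ
  have hΦa : ∀ x, Φ x = (φ x : ℂ) := fun x => by simp [hΦ]
  have e1 := congrArg (fun T => T Φ) (Lp.fourier_toTemperedDistribution_eq (h2.toLp g))
  simp only [TemperedDistribution.fourier_apply, Lp.toTemperedDistribution_apply] at e1
  have e2 : ∫ ξ, 𝓕 (Φ : ℝ → ℂ) ξ • g ξ = ∫ x, Φ x • 𝓕 g x := by
    simpa using! VectorFourier.integral_fourierIntegral_smul_eq_flip (L := innerₗ ℝ)
      Real.continuous_fourierChar continuous_inner Φ.integrable h1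
  have e3 : ∫ ξ, (𝓕 Φ) ξ • (h2.toLp g) ξ = ∫ ξ, 𝓕 (Φ : ℝ → ℂ) ξ • g ξ := by
    refine integral_congr_ae ?_
    filter_upwards [h2.coeFn_toLp] with x hx
    rw [hx, fourier_coe]
  rw [e3, e2] at e1
  simpa [hΦa] using e1.symm

theorem lintegral_enorm_fourier_sq {g : ℝ → ℂ} (h1 : Integrable g) (h2 : MemLp g 2) :
    ∫⁻ w, ‖𝓕 g w‖ₑ ^ 2 = ∫⁻ x, ‖g x‖ₑ ^ 2 := by
  have key : eLpNorm (𝓕 g) 2 volume = eLpNorm g 2 volume := by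
    rw [← eLpNorm_congr_ae (Lp_fourier_toLp_ae_eq h1 h2), ← eLpNorm_congr_ae h2.coeFn_toLp,
      ← Lp.enorm_def, ← Lp.enorm_def, ← ofReal_norm, ← ofReal_norm, Lp.norm_fourier_eq]
  refine ENNReal.rpow_left_injective (x := 2⁻¹) (by norm_num) ?_
  simpa [eLpNorm_eq_lintegral_rpow_enorm_toReal (p := 2) (by norm_num) (by norm_num)] using key

/-- The integral is the Fourier transform at `-(k / 2π) v`; the constant is the Jacobian of this
dilation. -/
theorem lintegral_enorm_integral_cexp_sq {g : ℝ → ℂ} (h1 : Integrable g) (h2 : MemLp g 2)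
    {k : ℝ} (hk : 0 < k) :
    ∫⁻ v : ℝ, ‖∫ x : ℝ, Complex.exp (k * v * x * Complex.I) * g x‖ₑ ^ 2
      = ENNReal.ofReal (2 * Real.pi / k) * ∫⁻ x, ‖g x‖ₑ ^ 2 := by
  have hc : (-(k / (2 * Real.pi))) ≠ 0 := by
    have := Real.pi_pos; apply neg_ne_zero.2; positivity
  have hF : ∀ v : ℝ, ∫ x : ℝ, Complex.exp (k * v * x * Complex.I) * g x
      = 𝓕 g (-(k / (2 * Real.pi)) * v) := by
    intro v
    rw [Real.fourier_real_eq_integral_exp_smul]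
    congr 1; ext x
    rw [smul_eq_mul]
    congr 2
    push_cast
    field_simp
  have hcont : Continuous (𝓕 g) :=
    VectorFourier.fourierIntegral_continuous Real.continuous_fourierChar
      (L := innerₗ ℝ) continuous_inner h1
  have hm : Measurable fun w => ‖𝓕 g w‖ₑ ^ 2 := by
    have := hcont.enorm.measurable; fun_prop
  simp_rw [hF]
  rw [← lintegral_map hm (measurable_const_mul _), Real.map_volume_mul_left hc,
    lintegral_smul_measure, lintegral_enorm_fourier_sq h1 h2, smul_eq_mul]
  congr 2
  rw [inv_neg, abs_neg, inv_div, abs_of_pos (by have := Real.pi_pos; positivity)]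

end Plancherel

/-! ### Differentiation under the integral for exponentials in a Banach algebra -/

section ExpIntegral

/-- Noncommutative telescoping: one factor is exchanged at a time. The truncated `n - 1` at `n = 0`
is harmless because of the factor `n`. -/
theorem norm_pow_sub_pow_le {𝔸 : Type*} [NormedRing 𝔸] [NormOneClass 𝔸] {a b : 𝔸} {M : ℝ}
    (ha : ‖a‖ ≤ M) (hb : ‖b‖ ≤ M) (n : ℕ) : ‖a ^ n - b ^ n‖ ≤ n * M ^ (n - 1) * ‖a - b‖ := by
  have hM : 0 ≤ M := (norm_nonneg a).trans ha
  induction n with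
  | zero => simp
  | succ n ih =>
    have e : a ^ (n + 1) - b ^ (n + 1) = a * (a ^ n - b ^ n) + (a - b) * b ^ n := by
      rw [pow_succ', pow_succ']; noncomm_ring
    have h1 : ‖a * (a ^ n - b ^ n)‖ ≤ M * (n * M ^ (n - 1) * ‖a - b‖) :=
      (norm_mul_le _ _).trans (mul_le_mul ha ih (norm_nonneg _) hM)
    have h2 : ‖(a - b) * b ^ n‖ ≤ ‖a - b‖ * M ^ n :=
      (norm_mul_le _ _).trans (mul_le_mul_of_nonneg_left
        ((norm_pow_le _ _).trans (pow_le_pow_left₀ (norm_nonneg _) hb n)) (norm_nonneg _))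
    have h3 : M * (n * M ^ (n - 1) * ‖a - b‖) = n * M ^ n * ‖a - b‖ := by
      cases n with
      | zero => simp
      | succ n => simp [pow_succ]; ring
    rw [e]
    refine (norm_add_le _ _).trans ((add_le_add h1 h2).trans (le_of_eq ?_))
    rw [h3]; push_cast; ring

theorem continuous_exp_of_normedAlgebra (𝕜 : Type*) {𝔸 : Type*} [RCLike 𝕜] [NormedRing 𝔸]
    [NormedAlgebra 𝕜 𝔸] [CompleteSpace 𝔸] : Continuous (NormedSpace.exp : 𝔸 → 𝔸) :=
  continuous_iff_continuousAt.2 fun q => (NormedSpace.exp_analytic (𝕂 := 𝕜) q).continuousAt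

theorem norm_exp_sub_exp_le (𝕜 : Type*) {𝔸 : Type*} [RCLike 𝕜] [NormedRing 𝔸] [NormOneClass 𝔸]
    [NormedAlgebra 𝕜 𝔸] [CompleteSpace 𝔸] {a b : 𝔸} {M : ℝ} (ha : ‖a‖ ≤ M) (hb : ‖b‖ ≤ M) :
    ‖NormedSpace.exp a - NormedSpace.exp b‖ ≤ Real.exp M * ‖a - b‖ := by
  have hM : 0 ≤ M := (norm_nonneg a).trans ha
  have h := (NormedSpace.exp_series_hasSum_exp' (𝕂 := 𝕜) a).sub
    (NormedSpace.exp_series_hasSum_exp' (𝕂 := 𝕜) b)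
  have hs : HasSum (fun n : ℕ => (n.factorial : ℝ)⁻¹ * (n * M ^ (n - 1) * ‖a - b‖))
      (Real.exp M * ‖a - b‖) := by
    rw [← hasSum_nat_add_iff' 1]
    have := (NormedSpace.exp_series_hasSum_exp' (𝕂 := ℝ) M).mul_right ‖a - b‖
    rw [← Real.exp_eq_exp_ℝ] at this
    simp only [Finset.range_one, Finset.sum_singleton, Nat.cast_zero, zero_mul, mul_zero, sub_zero]
    refine this.congr_fun fun n => ?_
    rw [Nat.factorial_succ]
    have := Nat.factorial_ne_zero n
    push_cast
    simp only [smul_eq_mul]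
    field_simp
  rw [← h.tsum_eq]
  refine tsum_of_norm_bounded hs fun n => ?_
  rw [← smul_sub]
  refine (norm_smul_le _ _).trans ?_
  rw [norm_inv, RCLike.norm_natCast]
  gcongr
  exact norm_pow_sub_pow_le ha hb n

variable {𝕜 𝔸 : Type*} [RCLike 𝕜] [NormedRing 𝔸] [NormOneClass 𝔸] [NormedAlgebra 𝕜 𝔸] (a b : 𝕜)

theorem norm_exp_quadratic_sub_le [CompleteSpace 𝔸] {q q' : 𝔸} {r : ℝ} (hq : ‖q‖ ≤ r)
    (hq' : ‖q'‖ ≤ r) (x : ℝ) :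
    ‖NormedSpace.exp (a • q ^ 2 + (b * x) • q) - NormedSpace.exp (a • q' ^ 2 + (b * x) • q')‖
      ≤ (2 * ‖a‖ * r + 1) * Real.exp (‖a‖ * r ^ 2) * Real.exp (‖b‖ * (r + 1) * |x|)
        * ‖q - q'‖ := by
  have hr : 0 ≤ r := (norm_nonneg _).trans hq
  have hM : ∀ p : 𝔸, ‖p‖ ≤ r → ‖a • p ^ 2 + (b * x) • p‖ ≤ ‖a‖ * r ^ 2 + ‖b‖ * |x| * r := by
    intro p hp
    refine (norm_add_le _ _).trans (add_le_add ?_ ?_)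
    · refine (norm_smul_le _ _).trans ?_
      gcongr
      exact (norm_pow_le _ _).trans (pow_le_pow_left₀ (norm_nonneg _) hp 2)
    · refine (norm_smul_le _ _).trans ?_
      rw [norm_mul, RCLike.norm_ofReal]
      gcongr
  refine (norm_exp_sub_exp_le 𝕜 (hM q hq) (hM q' hq')).trans ?_
  have hd : ‖a • q ^ 2 + (b * x) • q - (a • q' ^ 2 + (b * x) • q')‖
      ≤ (2 * ‖a‖ * r + ‖b‖ * |x|) * ‖q - q'‖ := by
    rw [add_sub_add_comm, ← smul_sub, ← smul_sub]
    refine (norm_add_le _ _).trans ?_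
    rw [add_mul]
    refine add_le_add ((norm_smul_le _ _).trans ?_) ((norm_smul_le _ _).trans ?_)
    · have := norm_pow_sub_pow_le hq hq' 2
      simp only [Nat.cast_ofNat, Nat.add_one_sub_one, pow_one] at this
      calc ‖a‖ * ‖q ^ 2 - q' ^ 2‖ ≤ ‖a‖ * (2 * r * ‖q - q'‖) := by gcongr
        _ = _ := by ring
    · rw [norm_mul, RCLike.norm_ofReal]
  have hb0 : 0 ≤ ‖b‖ * |x| := by positivity
  -- The linear growth in `|x|` is absorbed by an extra exponential, whence the `r + 1` instead of
  -- `r` in the final exponent.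
  have he : 2 * ‖a‖ * r + ‖b‖ * |x| ≤ (2 * ‖a‖ * r + 1) * Real.exp (‖b‖ * |x|) := by
    have h1 := Real.add_one_le_exp (‖b‖ * |x|)
    have h2 : 0 ≤ 2 * ‖a‖ * r := by positivity
    nlinarith
  calc _ ≤ Real.exp (‖a‖ * r ^ 2 + ‖b‖ * |x| * r) *
        ((2 * ‖a‖ * r + 1) * Real.exp (‖b‖ * |x|) * ‖q - q'‖) := by
        gcongr
        exact hd.trans (by gcongr)
    _ = _ := by
      rw [Real.exp_add, show ‖b‖ * (r + 1) * |x| = ‖b‖ * |x| * r + ‖b‖ * |x| by ring, Real.exp_add]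
      ring

theorem norm_exp_quadratic_le [CompleteSpace 𝔸] (q : 𝔸) (x : ℝ) :
    ‖NormedSpace.exp (a • q ^ 2 + (b * x) • q)‖
      ≤ 1 + (2 * ‖a‖ * ‖q‖ + 1) * Real.exp (‖a‖ * ‖q‖ ^ 2) *
        Real.exp (‖b‖ * (‖q‖ + 1) * |x|) * ‖q‖ := by
  have := norm_exp_quadratic_sub_le a b (q := q) (q' := 0) le_rfl (by simp) x
  simp only [ne_eq, OfNat.ofNat_ne_zero, not_false_eq_true, zero_pow, smul_zero, add_zero,
    NormedSpace.exp_zero, sub_zero] at this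
  calc _ = ‖1 + (NormedSpace.exp (a • q ^ 2 + (b * (x : 𝕜)) • q) - 1)‖ := by congr 1; abel
    _ ≤ 1 + _ := (norm_add_le _ _).trans (by rw [norm_one])
    _ ≤ _ := by gcongr

theorem integrable_exp_quadratic_mul [CompleteSpace 𝔸] {g : ℝ → 𝔸}
    (hgm : AEStronglyMeasurable g) (hg : ∀ K : ℝ, Integrable fun x => Real.exp (K * |x|) * ‖g x‖)
    (q : 𝔸) : Integrable fun x : ℝ => NormedSpace.exp (a • q ^ 2 + (b * x) • q) * g x := by
  have hc : Continuous fun x : ℝ => NormedSpace.exp (a • q ^ 2 + (b * (x : 𝕜)) • q) :=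
    (continuous_exp_of_normedAlgebra 𝕜).comp (by fun_prop)
  set C := (2 * ‖a‖ * ‖q‖ + 1) * Real.exp (‖a‖ * ‖q‖ ^ 2) * ‖q‖
  refine ((hg 0).add ((hg (‖b‖ * (‖q‖ + 1))).const_mul C)).mono'
    (hc.aestronglyMeasurable.mul hgm) (ae_of_all _ fun x => ?_)
  refine (norm_mul_le _ _).trans
    ((mul_le_mul_of_nonneg_right (norm_exp_quadratic_le a b q x) (norm_nonneg _)).trans
      (le_of_eq ?_))
  simp only [Pi.add_apply, zero_mul, Real.exp_zero, one_mul, C]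
  ring

/-- Domination uses the Lipschitz bound rather than the derivative of `exp`, which has no simple
closed form when the algebra is not commutative. With `𝕜 = ℝ`, `𝔸 = ℍ` this gives real
differentiability of the transform; with `𝕜 = 𝔸 = ℂ` it gives that the complex transform is entire.
-/
theorem differentiable_integral_exp_quadratic_mul [NormedSpace ℝ 𝔸] [CompleteSpace 𝔸] {g : ℝ → 𝔸}
    (hgm : AEStronglyMeasurable g)
    (hg : ∀ K : ℝ, Integrable fun x => Real.exp (K * |x|) * ‖g x‖) :
    Differentiable 𝕜 fun q : 𝔸 => ∫ x : ℝ, NormedSpace.exp (a • q ^ 2 + (b * x) • q) * g x := by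
  intro q₀
  have hE : ContDiff 𝕜 1 (Function.uncurry fun (t : 𝕜) (q : 𝔸) =>
      NormedSpace.exp (a • q ^ 2 + (b * t) • q)) := by
    have h1 : ContDiff 𝕜 1 (NormedSpace.exp : 𝔸 → 𝔸) :=
      contDiff_iff_contDiffAt.2 fun q => (NormedSpace.exp_analytic (𝕂 := 𝕜) q).contDiffAt
    refine h1.comp ?_
    simp only [pow_two]
    fun_prop
  -- Joint smoothness in `(t, q)` is needed only for this: it makes the derivative measurable in the
  -- integration variable.
  have hD : Continuous fun t : 𝕜 =>
      fderiv 𝕜 (fun q : 𝔸 => NormedSpace.exp (a • q ^ 2 + (b * t) • q)) q₀ :=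
    (hE.fderiv (m := 1) (n := 0) (g := fun _ => q₀) contDiff_const (by simp)).continuous
  set r := ‖q₀‖ + 1
  set C := (2 * ‖a‖ * r + 1) * Real.exp (‖a‖ * r ^ 2)
  have hdiff : ∀ (t : 𝕜), DifferentiableAt 𝕜
      (fun q : 𝔸 => NormedSpace.exp (a • q ^ 2 + (b * t) • q)) q₀ := fun t =>
    ((hE.comp (contDiff_prodMk_right t)).differentiable (by norm_num)) q₀
  refine (hasFDerivAt_integral_of_dominated_loc_of_lip' (𝕜 := 𝕜)
    (F' := fun x : ℝ => (ContinuousLinearMap.compL 𝕜 𝔸 𝔸 𝔸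
      ((ContinuousLinearMap.mul 𝕜 𝔸).flip (g x)))
      (fderiv 𝕜 (fun q : 𝔸 => NormedSpace.exp (a • q ^ 2 + (b * (x : 𝕜)) • q)) q₀))
    (bound := fun x => C * (Real.exp (‖b‖ * (r + 1) * |x|) * ‖g x‖))
    (Metric.ball_mem_nhds q₀ one_pos) (fun q _ => ?_)
    (integrable_exp_quadratic_mul a b hgm hg q₀) ?_ (ae_of_all _ fun x q hq => ?_)
    ((hg _).const_mul C) (ae_of_all _ fun x => ?_)).2.differentiableAt
  · exact (integrable_exp_quadratic_mul a b hgm hg q).aestronglyMeasurable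
  · refine ContinuousLinearMap.aestronglyMeasurable_comp₂ _ ?_ ?_
    · exact (ContinuousLinearMap.continuous _).comp_aestronglyMeasurable hgm
    · exact (hD.comp RCLike.continuous_ofReal).aestronglyMeasurable
  · rw [← sub_mul]
    have hq' : ‖q‖ ≤ r := by
      have := norm_le_norm_add_norm_sub' q q₀
      rw [mem_ball_iff_norm] at hq
      simp only [r]; linarith
    refine (norm_mul_le _ _).trans ?_
    calc _ ≤ (C * Real.exp (‖b‖ * (r + 1) * |x|) * ‖q - q₀‖) * ‖g x‖ := by
          gcongr
          exact norm_exp_quadratic_sub_le a b hq' (by simp [r]) x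
      _ = _ := by ring
  · exact ((ContinuousLinearMap.mul 𝕜 𝔸).flip (g x)).hasFDerivAt.comp q₀
      (hdiff x).hasFDerivAt

end ExpIntegral

/-! ### Integrability of Gaussians with a linear term -/

section Gaussian

variable {V : Type*} [NormedAddCommGroup V] [InnerProductSpace ℝ V] [FiniteDimensional ℝ V]
  [MeasurableSpace V] [BorelSpace V]

theorem integrable_exp_neg_mul_norm_sq {b : ℝ} (hb : 0 < b) :
    Integrable fun v : V => Real.exp (-b * ‖v‖ ^ 2) := by
  have h := (GaussianFourier.integrable_cexp_neg_mul_sq_norm_add (V := V) (b := (b : ℂ))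
    (by simpa using hb) 0 0).norm
  refine h.congr (ae_of_all _ fun v => ?_)
  simp only [Complex.norm_exp]
  norm_cast
  simp

theorem integrable_exp_linear_sub_sq {b : ℝ} (hb : 0 < b) (K : ℝ) :
    Integrable fun v : V => Real.exp (K * ‖v‖ - b * ‖v‖ ^ 2) := by
  refine ((integrable_exp_neg_mul_norm_sq (V := V) (half_pos hb)).const_mul
    (Real.exp (K ^ 2 / (2 * b)))).mono' (by fun_prop) (ae_of_all _ fun v => ?_)
  rw [Real.norm_of_nonneg (Real.exp_pos _).le, ← Real.exp_add]
  refine Real.exp_le_exp.2 ?_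
  -- Completing the square, with half of the quadratic decay kept for integrability.
  have h : K ^ 2 / (2 * b) + -(b / 2) * ‖v‖ ^ 2 - (K * ‖v‖ - b * ‖v‖ ^ 2)
      = (K - b * ‖v‖) ^ 2 / (2 * b) := by field_simp; ring
  have : 0 ≤ (K - b * ‖v‖) ^ 2 / (2 * b) := by positivity
  linarith

theorem memLp_exp_linear_sub_sq {b : ℝ} (hb : 0 < b) (K : ℝ) :
    MemLp (fun v : V => Real.exp (K * ‖v‖ - b * ‖v‖ ^ 2)) 2 := by
  rw [memLp_two_iff_integrable_sq (by fun_prop)]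
  refine (integrable_exp_linear_sub_sq (V := V) (b := 2 * b) (by positivity) (2 * K)).congr
    (ae_of_all _ fun v => ?_)
  simp only [← Real.exp_nat_mul]
  congr 1; push_cast; ring

theorem integrable_exp_mul_norm_gaussian_smul {F : Type*} [NormedAddCommGroup F] [NormedSpace ℝ F]
    {b : ℝ} (hb : 0 < b) {ψ : V → F} (hψ : MemLp ψ 2) (K : ℝ) :
    Integrable fun x : V => Real.exp (K * ‖x‖) * ‖Real.exp (-b * ‖x‖ ^ 2) • ψ x‖ := by
  refine ((memLp_exp_linear_sub_sq (V := V) hb K).integrable_mul hψ.norm).congr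
    (ae_of_all _ fun x => ?_)
  simp only [Pi.mul_apply, norm_smul, Real.norm_of_nonneg (Real.exp_pos _).le, ← mul_assoc,
    ← Real.exp_add]
  congr 2; ring

end Gaussian

/-! ### The complex Segal-Bargmann transform -/

section ComplexKernel

/-- The Segal-Bargmann kernel on the complex plane. -/
def kernelC (ν : ℝ) (z : ℂ) (x : ℝ) : ℂ :=
  ((ν / Real.pi) ^ (3 / 4 : ℝ) : ℝ) *
    Complex.exp (-(ν / 2) * (z ^ 2 + x ^ 2) + ν * √2 * (z * x))

theorem continuous_kernelC (ν : ℝ) : Continuous fun p : ℂ × ℝ => kernelC ν p.1 p.2 := by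
  unfold kernelC; fun_prop

theorem norm_kernelC {ν : ℝ} (hν : 0 < ν) (z : ℂ) (x : ℝ) :
    ‖kernelC ν z x‖ = (ν / Real.pi) ^ (3 / 4 : ℝ) *
      Real.exp (-(ν / 2) * (z.re ^ 2 - z.im ^ 2 + x ^ 2) + ν * √2 * (z.re * x)) := by
  have hc : 0 ≤ (ν / Real.pi) ^ (3 / 4 : ℝ) := by have := Real.pi_pos; positivity
  rw [kernelC, norm_mul, Complex.norm_real, Real.norm_of_nonneg hc, Complex.norm_exp]
  congr 2
  simp [pow_two]

/-- Uniform over a disc of radius `R`, and square integrable in `x`: this one Gaussian majorant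
serves all later domination arguments on discs. -/
theorem norm_kernelC_le {ν : ℝ} (hν : 0 < ν) {z : ℂ} {R : ℝ} (hz : ‖z‖ ≤ R) (x : ℝ) :
    ‖kernelC ν z x‖ ≤ (ν / Real.pi) ^ (3 / 4 : ℝ) * Real.exp (ν / 2 * R ^ 2) *
      Real.exp (ν * √2 * R * ‖x‖ - ν / 2 * ‖x‖ ^ 2) := by
  rw [norm_kernelC hν, mul_assoc (_ ^ _), ← Real.exp_add]
  have hpi := Real.pi_pos
  refine mul_le_mul_of_nonneg_left (Real.exp_le_exp.2 ?_) (by positivity)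
  have h1 : z.re ^ 2 + z.im ^ 2 ≤ R ^ 2 := by
    rw [pow_two, pow_two, ← Complex.normSq_apply, Complex.normSq_eq_norm_sq]; gcongr
  have h2 : z.re * x ≤ R * ‖x‖ := by
    refine (le_abs_self _).trans ?_
    rw [abs_mul, Real.norm_eq_abs]
    gcongr
    exact (Complex.abs_re_le_norm z).trans hz
  have h3 : ν * √2 * (z.re * x) ≤ ν * √2 * (R * ‖x‖) := by gcongr
  have h4 : ν / 2 * (z.im ^ 2 - z.re ^ 2) ≤ ν / 2 * R ^ 2 := by gcongr; nlinarith [sq_nonneg z.re]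
  have h5 : ‖x‖ ^ 2 = x ^ 2 := by simp
  rw [h5]
  linarith

theorem memLp_kernelC {ν : ℝ} (hν : 0 < ν) (z : ℂ) : MemLp (kernelC ν z) 2 := by
  refine ((memLp_exp_linear_sub_sq (V := ℝ) (half_pos hν) (ν * √2 * ‖z‖)).const_mul
    ((ν / Real.pi) ^ (3 / 4 : ℝ) * Real.exp (ν / 2 * ‖z‖ ^ 2))).mono
    ((continuous_kernelC ν).comp (Continuous.prodMk_right z)).aestronglyMeasurable
    (ae_of_all _ fun x => ?_)
  exact (norm_kernelC_le hν le_rfl x).trans (le_abs_self _)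

/-- The Segal-Bargmann transform on complex-valued functions. -/
def transformC (ν : ℝ) (ψ : ℝ → ℂ) (z : ℂ) : ℂ := ∫ x : ℝ, kernelC ν z x * ψ x

theorem kernelC_mul_eq (ν : ℝ) (ψ : ℝ → ℂ) (z : ℂ) (x : ℝ) :
    kernelC ν z x * ψ x = ((ν / Real.pi) ^ (3 / 4 : ℝ) : ℝ) *
      (NormedSpace.exp ((-(ν / 2 : ℂ)) • z ^ 2 + ((ν * √2 : ℂ) * (x : ℂ)) • z) *
        (Real.exp (-(ν / 2) * ‖x‖ ^ 2) • ψ x)) := by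
  rw [kernelC, ← Complex.exp_eq_exp_ℂ, Complex.real_smul, mul_assoc, ← mul_assoc (Complex.exp _),
    Complex.ofReal_exp, ← Complex.exp_add]
  congr 3
  simp only [smul_eq_mul, Real.norm_eq_abs, sq_abs]
  push_cast; ring

theorem differentiable_transformC {ν : ℝ} (hν : 0 < ν) {ψ : ℝ → ℂ} (hψ : MemLp ψ 2) :
    Differentiable ℂ (transformC ν ψ) := by
  have h := differentiable_integral_exp_quadratic_mul (𝔸 := ℂ) (-(ν / 2 : ℂ)) (ν * √2 : ℂ)
    (g := fun x => Real.exp (-(ν / 2) * ‖x‖ ^ 2) • ψ x)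
    ((by fun_prop : Continuous fun x : ℝ => Real.exp (-(ν / 2) * ‖x‖ ^ 2)).aestronglyMeasurable.smul
      hψ.1) (integrable_exp_mul_norm_gaussian_smul (half_pos hν) hψ)
  have e : transformC ν ψ = fun z => ((ν / Real.pi) ^ (3 / 4 : ℝ) : ℝ) *
      ∫ x : ℝ, NormedSpace.exp ((-(ν / 2 : ℂ)) • z ^ 2 + ((ν * √2 : ℂ) * (x : ℂ)) • z) *
        (Real.exp (-(ν / 2) * ‖x‖ ^ 2) • ψ x) := by
    funext z
    simp only [transformC, kernelC_mul_eq]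
    rw [integral_const_mul]
  rw [e]
  exact h.const_mul _

/-- A Gaussian integral whose exponent is `(ν/2)((z + w)² - z² - w²)`. It shows that the transform
sends kernel sections to multiples of the reproducing kernel of the Fock space. -/
theorem integral_kernelC_mul_kernelC {ν : ℝ} (hν : 0 < ν) (z w : ℂ) :
    ∫ x : ℝ, kernelC ν z x * kernelC ν w x = (ν / Real.pi) * Complex.exp (ν * (z * w)) := by
  have hpi := Real.pi_pos
  have e : ∀ x : ℝ, kernelC ν z x * kernelC ν w x = ((ν / Real.pi) ^ (3 / 2 : ℝ) : ℝ) *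
      Complex.exp (-(ν : ℂ) * x ^ 2 + (ν * √2 * (z + w)) * x + -(ν / 2) * (z ^ 2 + w ^ 2)) := by
    intro x
    have hc : ((ν / Real.pi) ^ (3 / 2 : ℝ) : ℝ)
        = (ν / Real.pi) ^ (3 / 4 : ℝ) * (ν / Real.pi) ^ (3 / 4 : ℝ) := by
      rw [← Real.rpow_add (by positivity)]; norm_num
    rw [hc, kernelC, kernelC, mul_mul_mul_comm, ← Complex.exp_add]
    push_cast
    congr 2
    ring
  simp_rw [e]
  rw [integral_const_mul, integral_cexp_quadratic (by simpa using hν), ← mul_assoc]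
  have h2 : ((√2 : ℝ) : ℂ) ^ 2 = 2 := by rw [← Complex.ofReal_pow]; simp
  congr 1
  · rw [neg_neg, show ((Real.pi : ℂ) / ν) ^ (1 / 2 : ℂ) = (((Real.pi / ν) ^ (1 / 2 : ℝ) : ℝ) : ℂ) by
      rw [Complex.ofReal_cpow (by positivity)]; push_cast; rfl]
    norm_cast
    rw [← inv_div ν Real.pi, Real.inv_rpow (by positivity), ← div_eq_mul_inv,
      ← Real.rpow_sub (by positivity)]
    norm_num
  · congr 1
    have : (ν : ℂ) ≠ 0 := by exact_mod_cast hν.ne'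
    field_simp
    linear_combination (2 * (z + w) ^ 2) * h2

/-- The factor `exp(-(ν/2) z²)` contributes `exp(-ν(u² - v²))` to the squared modulus, and the
weight turns this into `exp(-2νu²)`. What depends on `v` is then a pure Fourier integral. -/
theorem norm_transformC_sq_mul {ν : ℝ} (hν : 0 < ν) (ψ : ℝ → ℂ) (u v : ℝ) :
    ‖transformC ν ψ ⟨u, v⟩‖ ^ 2 * Real.exp (-ν * ‖(⟨u, v⟩ : ℂ)‖ ^ 2)
      = (ν / Real.pi) ^ (3 / 2 : ℝ) * Real.exp (-2 * ν * u ^ 2) *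
        ‖∫ x : ℝ, Complex.exp ((ν * √2 : ℝ) * v * x * Complex.I) *
          (Real.exp (ν * √2 * u * x - ν / 2 * x ^ 2) * ψ x)‖ ^ 2 := by
  have hpi := Real.pi_pos
  have hc : ((ν / Real.pi) ^ (3 / 2 : ℝ) : ℝ) = ((ν / Real.pi) ^ (3 / 4 : ℝ)) ^ 2 := by
    rw [← Real.rpow_mul_natCast (by positivity)]; norm_num
  have hz : (⟨u, v⟩ : ℂ) = u + v * Complex.I := by apply Complex.ext <;> simp
  have e : transformC ν ψ ⟨u, v⟩ = (((ν / Real.pi) ^ (3 / 4 : ℝ) : ℝ) *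
      Complex.exp (-(ν / 2) * (u + v * Complex.I) ^ 2)) *
        ∫ x : ℝ, Complex.exp ((ν * √2 : ℝ) * v * x * Complex.I) *
          (Real.exp (ν * √2 * u * x - ν / 2 * x ^ 2) * ψ x) := by
    rw [transformC, ← integral_const_mul]
    congr 1; ext x
    have hx : Complex.exp (-(ν / 2) * ((u + v * Complex.I) ^ 2 + x ^ 2) +
        ν * √2 * ((u + v * Complex.I) * x)) = Complex.exp (-(ν / 2) * (u + v * Complex.I) ^ 2) *
        (Complex.exp ((ν * √2 : ℝ) * v * x * Complex.I) *
          Real.exp (ν * √2 * u * x - ν / 2 * x ^ 2)) := by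
      rw [Complex.ofReal_exp, ← Complex.exp_add, ← Complex.exp_add]
      congr 1
      push_cast; ring
    rw [kernelC, hz, hx]
    ring
  rw [e, norm_mul, norm_mul, Complex.norm_real, Real.norm_of_nonneg (by positivity),
    Complex.norm_exp, mul_pow, mul_pow, ← hc, mul_right_comm]
  congr 1
  rw [mul_assoc]
  congr 1
  rw [← Real.exp_nat_mul, ← Real.exp_add]
  congr 1
  rw [← Complex.normSq_eq_norm_sq, Complex.normSq_apply]
  simp [pow_two]
  ring

theorem lintegral_exp_neg_mul_sub_sq {ν : ℝ} (hν : 0 < ν) (x : ℝ) :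
    ∫⁻ u : ℝ, ENNReal.ofReal ((ν / Real.pi) ^ (3 / 2 : ℝ) * (2 * Real.pi / (ν * √2)) *
      Real.exp (-ν * (√2 * u - x) ^ 2)) = 1 := by
  have hpi := Real.pi_pos
  have hs : √2 ^ 2 = 2 := by simp
  have e : ∀ u : ℝ, Real.exp (-ν * (√2 * u - x) ^ 2)
      = Real.exp (-(2 * ν) * (u - x / √2) ^ 2) := by
    intro u
    congr 1
    have : √2 * u - x = √2 * (u - x / √2) := by field_simp
    rw [this, mul_pow, hs]; ring
  simp_rw [e]
  have hi : Integrable fun u : ℝ => Real.exp (-(2 * ν) * (u - x / √2) ^ 2) :=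
    (integrable_exp_neg_mul_sq (b := 2 * ν) (by positivity)).comp_sub_right (x / √2)
  rw [← ofReal_integral_eq_lintegral_ofReal (hi.const_mul _)
    (ae_of_all _ fun u => by positivity), integral_const_mul,
    integral_sub_right_eq_self (fun u : ℝ => Real.exp (-(2 * ν) * u ^ 2)) (x / √2),
    integral_gaussian, ENNReal.ofReal_eq_one]
  have h1 : (ν / Real.pi) ^ (3 / 2 : ℝ) = (ν / Real.pi) * √(ν / Real.pi) := by
    rw [Real.sqrt_eq_rpow, ← Real.rpow_one_add' (by positivity) (by norm_num)]; norm_num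
  have h2 : √(Real.pi / (2 * ν)) = √(Real.pi / ν) / √2 := by
    rw [← Real.sqrt_div (by positivity)]; congr 1; field_simp
  have h3 : √(ν / Real.pi) * √(Real.pi / ν) = 1 := by
    rw [← Real.sqrt_mul (by positivity)]
    rw [show ν / Real.pi * (Real.pi / ν) = 1 by field_simp]; simp
  rw [h1, h2]
  calc _ = (√(ν / Real.pi) * √(Real.pi / ν)) * (2 / √2 ^ 2) := by field_simp
    _ = 1 := by rw [h3, hs]; norm_num

/-- The complex Segal-Bargmann transform is isometric. -/
theorem lintegral_norm_transformC_sq {ν : ℝ} (hν : 0 < ν) {ψ : ℝ → ℂ} (hψ : MemLp ψ 2) :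
    ∫⁻ z : ℂ, ENNReal.ofReal (‖transformC ν ψ z‖ ^ 2 * Real.exp (-ν * ‖z‖ ^ 2))
      = ∫⁻ x, ‖ψ x‖ₑ ^ 2 := by
  have hpi := Real.pi_pos
  have hcont : Continuous (transformC ν ψ) := (differentiable_transformC hν hψ).continuous
  have hm : Measurable fun z : ℂ =>
      ENNReal.ofReal (‖transformC ν ψ z‖ ^ 2 * Real.exp (-ν * ‖z‖ ^ 2)) := by fun_prop
  rw [← Complex.volume_preserving_equiv_real_prod.symm.lintegral_comp hm, Measure.volume_eq_prod,
    lintegral_prod (fun a : ℝ × ℝ => ENNReal.ofReal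
      (‖transformC ν ψ (Complex.measurableEquivRealProd.symm a)‖ ^ 2 *
        Real.exp (-ν * ‖Complex.measurableEquivRealProd.symm a‖ ^ 2)))
      (hm.comp Complex.measurableEquivRealProd.symm.measurable).aemeasurable]
  simp only [Complex.measurableEquivRealProd_symm_apply]
  -- Plancherel in `v`, with frequency scale `k = ν√2`; the Gaussian factors then combine into a
  -- square in `√2 u - x`.
  have inner : ∀ u : ℝ, ∫⁻ v : ℝ, ENNReal.ofReal (‖transformC ν ψ ⟨u, v⟩‖ ^ 2 *
      Real.exp (-ν * ‖(⟨u, v⟩ : ℂ)‖ ^ 2)) = ∫⁻ x : ℝ, ENNReal.ofReal ((ν / Real.pi) ^ (3 / 2 : ℝ) *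
        (2 * Real.pi / (ν * √2)) * Real.exp (-ν * (√2 * u - x) ^ 2)) * ‖ψ x‖ₑ ^ 2 := by
    intro u
    have hG : MemLp (fun x : ℝ => Real.exp (ν * √2 * u * x - ν / 2 * x ^ 2)) 2 := by
      refine (memLp_exp_linear_sub_sq (V := ℝ) (half_pos hν) (ν * √2 * |u|)).mono (by fun_prop)
        (ae_of_all _ fun x => ?_)
      rw [Real.norm_of_nonneg (Real.exp_pos _).le, Real.norm_of_nonneg (Real.exp_pos _).le,
        Real.exp_le_exp, Real.norm_eq_abs, sq_abs, mul_assoc, mul_assoc _ |u|, ← abs_mul]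
      gcongr
      exact le_abs_self _
    -- Equivalent to `(√2 u - x)² ≥ 0`; boundedness keeps the damped `ψ` in `L²`.
    have hb : ∀ x : ℝ, ‖Real.exp (ν * √2 * u * x - ν / 2 * x ^ 2)‖ ≤ Real.exp (ν * u ^ 2) := by
      intro x
      rw [Real.norm_of_nonneg (Real.exp_pos _).le, Real.exp_le_exp]
      have : √2 ^ 2 = 2 := by simp
      have h0 := mul_nonneg hν.le (sq_nonneg (√2 * u - x))
      have h1 : ν * (√2 * u - x) ^ 2 = 2 * (ν * u ^ 2) -
          2 * (ν * √2 * u * x - ν / 2 * x ^ 2) := by linear_combination (ν * u ^ 2) * this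
      linarith
    have h1 : Integrable fun x : ℝ =>
        (Real.exp (ν * √2 * u * x - ν / 2 * x ^ 2) : ℂ) * ψ x :=
      hG.ofReal.integrable_mul hψ
    have h2 : MemLp (fun x : ℝ => (Real.exp (ν * √2 * u * x - ν / 2 * x ^ 2) : ℂ) * ψ x) 2 := by
      refine (hψ.const_mul (Real.exp (ν * u ^ 2) : ℂ)).mono h1.aestronglyMeasurable
        (ae_of_all _ fun x => ?_)
      rw [norm_mul, norm_mul, Complex.norm_real, Complex.norm_real,
        Real.norm_of_nonneg (Real.exp_pos (ν * u ^ 2)).le]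
      gcongr
      exact hb x
    have hP := lintegral_enorm_integral_cexp_sq h1 h2 (k := ν * √2) (by positivity)
    simp_rw [norm_transformC_sq_mul hν]
    have e : ∀ a : ℂ, ENNReal.ofReal ((ν / Real.pi) ^ (3 / 2 : ℝ) * Real.exp (-2 * ν * u ^ 2) *
        ‖a‖ ^ 2) = ENNReal.ofReal ((ν / Real.pi) ^ (3 / 2 : ℝ) * Real.exp (-2 * ν * u ^ 2)) *
        ‖a‖ₑ ^ 2 := by
      intro a
      rw [ENNReal.ofReal_mul (by positivity), ENNReal.ofReal_pow (norm_nonneg _), ofReal_norm]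
    simp_rw [e]
    rw [lintegral_const_mul' _ _ ENNReal.ofReal_ne_top, hP, ← mul_assoc,
      ← ENNReal.ofReal_mul (by positivity), ← lintegral_const_mul' _ _ ENNReal.ofReal_ne_top]
    refine lintegral_congr fun x => ?_
    rw [enorm_mul, mul_pow, ← mul_assoc]
    congr 1
    rw [← ofReal_norm, Complex.norm_real, Real.norm_of_nonneg (Real.exp_pos _).le,
      ← ENNReal.ofReal_pow (Real.exp_pos _).le, ← ENNReal.ofReal_mul (by positivity)]
    congr 1
    rw [← Real.exp_nat_mul]
    have : Real.exp (-ν * (√2 * u - x) ^ 2) = Real.exp (-2 * ν * u ^ 2) *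
        Real.exp ((2 : ℕ) * (ν * √2 * u * x - ν / 2 * x ^ 2)) := by
      rw [← Real.exp_add]
      congr 1
      have : √2 ^ 2 = 2 := by simp
      push_cast
      linear_combination (-ν * u ^ 2) * this
    rw [this]; ring
  simp_rw [inner]
  -- By Tonelli, `u` is integrated first, and the Gaussian in `u` has mass one for every `x`.
  rw [lintegral_lintegral_swap]
  · refine lintegral_congr fun x => ?_
    rw [lintegral_mul_const _ (by fun_prop), lintegral_exp_neg_mul_sub_sq hν, one_mul]
  · have h1 : AEMeasurable (fun p : ℝ × ℝ => ENNReal.ofReal ((ν / Real.pi) ^ (3 / 2 : ℝ) *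
        (2 * Real.pi / (ν * √2)) * Real.exp (-ν * (√2 * p.1 - p.2) ^ 2))) (volume.prod volume) := by
      fun_prop
    have h2 : AEMeasurable (fun p : ℝ × ℝ => ‖ψ p.2‖ₑ ^ 2) (volume.prod volume) :=
      hψ.1.comp_snd.enorm.pow_const 2
    exact h1.mul h2

/-- Mean value property of entire functions against the Gaussian weight. -/
theorem integral_exp_neg_mul_norm_sq_mul_entire {ν : ℝ} (hν : 0 < ν) {h : ℂ → ℂ}
    (hd : Differentiable ℂ h)
    (hi : Integrable fun z : ℂ => (Real.exp (-ν * ‖z‖ ^ 2) : ℂ) * h z) :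
    ∫ z : ℂ, (Real.exp (-ν * ‖z‖ ^ 2) : ℂ) * h z = (Real.pi / ν) * h 0 := by
  have hpi := Real.pi_pos
  set H : ℂ → ℂ := fun z => (Real.exp (-ν * ‖z‖ ^ 2) : ℂ) * h z
  have hrot : ∀ θ : ℝ, MeasurePreserving (fun z : ℂ => circleMap 0 1 θ * z) := by
    intro θ
    have := (rotation (Circle.exp θ)).measurePreserving
    convert this using 2 with z
    simp [circleMap]
  have hrotI : ∀ θ : ℝ, ∫ z : ℂ, H (circleMap 0 1 θ * z) = ∫ z, H z := by
    intro θ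
    have := (rotation (Circle.exp θ)).measurePreserving.integral_comp
      (rotation (Circle.exp θ)).toHomeomorph.measurableEmbedding H
    rw [← this]
    simp [circleMap]
  have hHc : Continuous H := by
    have := hd.continuous
    fun_prop
  have hint : Integrable (Function.uncurry fun (θ : ℝ) (z : ℂ) => H (circleMap 0 1 θ * z))
      ((volume.restrict (Set.uIoc 0 (2 * Real.pi))).prod volume) := by
    have hc : Continuous (Function.uncurry fun (θ : ℝ) (z : ℂ) => H (circleMap 0 1 θ * z)) := by
      unfold Function.uncurry
      have := continuous_circleMap 0 1
      fun_prop
    rw [integrable_prod_iff hc.aestronglyMeasurable]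
    refine ⟨ae_of_all _ fun θ => (hrot θ).integrable_comp_of_integrable hi, ?_⟩
    have : (fun θ : ℝ => ∫ z : ℂ, ‖Function.uncurry
        (fun (θ : ℝ) (z : ℂ) => H (circleMap 0 1 θ * z)) (θ, z)‖) = fun _ => ∫ z, ‖H z‖ := by
      funext θ
      have := (rotation (Circle.exp θ)).measurePreserving.integral_comp
        (rotation (Circle.exp θ)).toHomeomorph.measurableEmbedding (fun z => ‖H z‖)
      rw [← this]
      simp [circleMap]
    rw [this]
    have : IsFiniteMeasure (volume.restrict (Set.uIoc 0 (2 * Real.pi))) := by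
      rw [Set.uIoc_of_le (by positivity)]; infer_instance
    exact integrable_const _
  have hmean : ∀ z : ℂ, ∫ θ in (0)..(2 * Real.pi), H (circleMap 0 1 θ * z)
      = (2 * Real.pi) * h 0 * (Real.exp (-ν * ‖z‖ ^ 2) : ℂ) := by
    intro z
    have hdz : Differentiable ℂ fun t : ℂ => h (t * z) := by fun_prop
    have := hdz.diffContOnCl.circleAverage (c := 0) (R := 1)
    rw [Real.circleAverage_def, zero_mul, inv_smul_eq_iff₀ (by positivity)] at this
    simp only [H, norm_mul, norm_circleMap_zero, abs_one, one_mul]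
    rw [intervalIntegral.integral_const_mul, this]
    simp; ring
  -- The average of `H` over rotations is computed in both orders: rotation invariance gives `2π ∫
  -- H`, the mean value property on circles gives `2π h(0)` times the Gaussian integral.
  have hsw := intervalIntegral_integral_swap hint
  simp_rw [hrotI, hmean] at hsw
  rw [intervalIntegral.integral_const, integral_const_mul] at hsw
  have hg : ∫ z : ℂ, (Real.exp (-ν * ‖z‖ ^ 2) : ℂ) = (Real.pi / ν) := by
    rw [integral_complex_ofReal, GaussianFourier.integral_rexp_neg_mul_sq_norm hν]
    simp
  rw [hg] at hsw
  have h2 : (2 * Real.pi : ℂ) ≠ 0 := by exact_mod_cast (by positivity : (2 * Real.pi) ≠ 0)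
  refine mul_left_cancel₀ h2 ?_
  simp at hsw
  linear_combination hsw

/-- The reproducing property of the Fock space. -/
theorem integral_exp_mul_conj_mul_entire {ν : ℝ} (hν : 0 < ν) {g : ℂ → ℂ}
    (hd : Differentiable ℂ g) (hg : MemLp (fun z => (Real.exp (-(ν / 2) * ‖z‖ ^ 2) : ℂ) * g z) 2)
    (w : ℂ) :
    ∫ z : ℂ, (Real.exp (-ν * ‖z‖ ^ 2) : ℂ) *
      (Complex.exp (ν * (starRingEnd ℂ z * w)) * g z) = (Real.pi / ν) * g w := by
  have hK : MemLp (fun z : ℂ => (Real.exp (-(ν / 2) * ‖z‖ ^ 2) : ℂ) *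
      Complex.exp (ν * (starRingEnd ℂ z * w))) 2 := by
    refine (memLp_exp_linear_sub_sq (V := ℂ) (half_pos hν) (ν * ‖w‖)).mono
      (by fun_prop) (ae_of_all _ fun z => ?_)
    rw [norm_mul, Complex.norm_real, Real.norm_of_nonneg (Real.exp_pos _).le,
      Real.norm_of_nonneg (Real.exp_pos _).le, Complex.norm_exp, ← Real.exp_add, Real.exp_le_exp]
    have h1 : (ν * (starRingEnd ℂ z * w)).re ≤ ν * (‖z‖ * ‖w‖) := by
      refine (Complex.re_le_norm _).trans ?_
      simp [abs_of_pos hν]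
    linarith
  have hi : Integrable fun z : ℂ => (Real.exp (-ν * ‖z‖ ^ 2) : ℂ) *
      (Complex.exp (ν * (starRingEnd ℂ z * w)) * g z) := by
    refine (hK.integrable_mul hg).congr (ae_of_all _ fun z => ?_)
    have : Real.exp (-ν * ‖z‖ ^ 2) = Real.exp (-(ν / 2) * ‖z‖ ^ 2) *
        Real.exp (-(ν / 2) * ‖z‖ ^ 2) := by rw [← Real.exp_add]; congr 1; ring
    simp only [Pi.mul_apply, this]
    push_cast; ring
  set T : ℂ → ℂ := fun z => (Real.exp (-ν * ‖z‖ ^ 2) : ℂ) *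
      (Complex.exp (ν * (starRingEnd ℂ z * w)) * g z) with hT
  -- After the translation `z = ζ + w`, the reproducing kernel cancels all of the shifted weight
  -- except a factor holomorphic in `ζ`. The claim becomes the mean value property at the origin,
  -- where `h 0 = g w`.
  set h : ℂ → ℂ := fun ζ => Complex.exp (-ν * (ζ * starRingEnd ℂ w)) * g (ζ + w) with hh
  have hTh : ∀ ζ, T (ζ + w) = (Real.exp (-ν * ‖ζ‖ ^ 2) : ℂ) * h ζ := by
    intro ζ
    simp only [hT, hh]
    have : (Real.exp (-ν * ‖ζ + w‖ ^ 2) : ℂ) * Complex.exp (ν * (starRingEnd ℂ (ζ + w) * w))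
        = Real.exp (-ν * ‖ζ‖ ^ 2) * Complex.exp (-ν * (ζ * starRingEnd ℂ w)) := by
      rw [Complex.ofReal_exp, Complex.ofReal_exp, ← Complex.exp_add, ← Complex.exp_add]
      congr 1
      push_cast
      rw [← Complex.mul_conj', ← Complex.mul_conj', map_add]
      ring
    linear_combination g (ζ + w) * this
  have hi' := hi.comp_add_right w
  simp_rw [hTh] at hi'
  have key := integral_exp_neg_mul_norm_sq_mul_entire hν (h := h) (by simp only [hh]; fun_prop) hi'
  rw [← integral_add_right_eq_self T w]
  simp_rw [hTh]
  rw [key]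
  simp [hh]

end ComplexKernel

/-! ### Slices of the quaternions and their complex coordinates -/

section Slice

variable {I : ℍ}

/-- The imaginary components of `I²` are `2 Re I` times those of `I`; a nonzero real part would make
`I` real, with a negative square. -/
theorem re_eq_zero_of_sq_eq_neg_one (hI : I ^ 2 = -1) : I.re = 0 := by
  rw [pow_two] at hI
  have h0 := congrArg QuaternionAlgebra.re hI
  have h1 := congrArg QuaternionAlgebra.imI hI
  have h2 := congrArg QuaternionAlgebra.imJ hI
  have h3 := congrArg QuaternionAlgebra.imK hI
  simp at h0 h1 h2 h3
  by_contra hr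
  have e1 : I.imI = 0 := by
    have : I.re * I.imI = 0 := by linarith
    simpa [hr] using this
  have e2 : I.imJ = 0 := by
    have : I.re * I.imJ = 0 := by linarith
    simpa [hr] using this
  have e3 : I.imK = 0 := by
    have : I.re * I.imK = 0 := by linarith
    simpa [hr] using this
  rw [e1, e2, e3] at h0
  nlinarith [mul_self_nonneg I.re]

theorem star_eq_neg_of_sq_eq_neg_one (hI : I ^ 2 = -1) : star I = -I :=
  Quaternion.star_eq_neg.2 (re_eq_zero_of_sq_eq_neg_one hI)

theorem norm_eq_one_of_sq_eq_neg_one (hI : I ^ 2 = -1) : ‖I‖ = 1 := by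
  have := congrArg norm hI
  rw [norm_pow, norm_neg, norm_one] at this
  exact (pow_eq_one_iff_of_nonneg (norm_nonneg _) two_ne_zero).1 this

/-- The parametrization of a slice as a homomorphism of real algebras. -/
def sliceHom (I : ℍ) (hI : I ^ 2 = -1) : ℂ →ₐ[ℝ] ℍ := Complex.liftAux I (by rw [← pow_two, hI])

theorem sliceHom_apply (hI : I ^ 2 = -1) (z : ℂ) : sliceHom I hI z = sliceMap I z := by
  simp [sliceHom, Complex.liftAux_apply, sliceMap, Quaternion.coe_mul_eq_smul]

/-- The parametrization of a slice as a continuous real-linear map. -/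
def sliceCLM (I : ℍ) : ℂ →L[ℝ] ℍ :=
  Complex.reCLM.smulRight (1 : ℍ) + Complex.imCLM.smulRight I

theorem sliceCLM_apply (I : ℍ) (z : ℂ) : sliceCLM I z = sliceMap I z := by
  have h : (z.re : ℍ) = z.re • (1 : ℍ) := by rw [← Quaternion.coe_mul_eq_smul, mul_one]
  rw [sliceMap, Quaternion.coe_mul_eq_smul, h]
  rfl

theorem sliceMap_mul (hI : I ^ 2 = -1) (z w : ℂ) :
    sliceMap I (z * w) = sliceMap I z * sliceMap I w := by
  simp only [← sliceHom_apply hI, map_mul]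

theorem sliceMap_ofReal (I : ℍ) (r : ℝ) : sliceMap I (r : ℂ) = r := by simp [sliceMap]

theorem sliceMap_I (I : ℍ) : sliceMap I Complex.I = I := by simp [sliceMap]

theorem star_sliceMap (hI : I ^ 2 = -1) (z : ℂ) :
    star (sliceMap I z) = sliceMap I (starRingEnd ℂ z) := by
  simp [sliceMap, star_eq_neg_of_sq_eq_neg_one hI, Quaternion.coe_mul_eq_smul]

theorem norm_sliceMap (hI : I ^ 2 = -1) (z : ℂ) : ‖sliceMap I z‖ = ‖z‖ := by
  have h : ((‖sliceMap I z‖ ^ 2 : ℝ) : ℍ) = ((‖z‖ ^ 2 : ℝ) : ℍ) := by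
    rw [pow_two, ← Quaternion.normSq_eq_norm_mul_self, ← Quaternion.self_mul_star,
      star_sliceMap hI, ← sliceMap_mul hI, Complex.mul_conj', ← Complex.ofReal_pow, sliceMap_ofReal]
  have h' : ‖sliceMap I z‖ ^ 2 = ‖z‖ ^ 2 := Quaternion.coe_injective h
  exact (pow_left_inj₀ (norm_nonneg _) (norm_nonneg _) two_ne_zero).1 h'

/-- The quaternion with given components. -/
def ofComponents (a b c d : ℝ) : ℍ := ⟨a, b, c, d⟩

@[simp] theorem re_ofComponents (a b c d : ℝ) : (ofComponents a b c d).re = a := rfl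
@[simp] theorem imI_ofComponents (a b c d : ℝ) : (ofComponents a b c d).imI = b := rfl
@[simp] theorem imJ_ofComponents (a b c d : ℝ) : (ofComponents a b c d).imJ = c := rfl
@[simp] theorem imK_ofComponents (a b c d : ℝ) : (ofComponents a b c d).imK = d := rfl

/-- The unit is the normalized imaginary part; a real quaternion lies on every slice, so `i` serves.
-/
theorem exists_eq_sliceMap (q : ℍ) : ∃ J : ℍ, J ^ 2 = -1 ∧ ∃ z : ℂ, q = sliceMap J z := by
  by_cases h : q.im = 0
  · refine ⟨ofComponents 0 1 0 0, by rw [pow_two]; ext <;> simp, q.re, ?_⟩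
    rw [sliceMap_ofReal]
    conv_lhs => rw [← Quaternion.re_add_im q, h, add_zero]
  · have hn : ‖q.im‖ ≠ 0 := norm_ne_zero_iff.2 h
    refine ⟨‖q.im‖⁻¹ • q.im, ?_, ⟨q.re, ‖q.im‖⟩, ?_⟩
    · rw [smul_pow, Quaternion.sq_eq_neg_normSq.2 (by simp), Quaternion.normSq_eq_norm_mul_self]
      ext <;> simp
      field_simp
    · simp only [sliceMap, Quaternion.coe_mul_eq_smul, smul_smul]
      rw [mul_inv_cancel₀ hn, one_smul, Quaternion.re_add_im]

/-- The left `ℂ_I`-linear coordinate `q ↦ Re q - i Re (I q)` on the quaternions. -/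
def sliceCoord (I : ℍ) : ℍ →L[ℝ] ℂ := LinearMap.toContinuousLinearMap
  { toFun := fun q => ⟨q.re, -(I * q).re⟩
    map_add' := fun p q => by apply Complex.ext <;> simp [mul_add]; ring
    map_smul' := fun c q => by apply Complex.ext <;> simp; ring }

theorem sliceCoord_apply (I q : ℍ) : sliceCoord I q = ⟨q.re, -(I * q).re⟩ := rfl

theorem sliceCoord_sliceMap_mul (hI : I ^ 2 = -1) (z : ℂ) (q : ℍ) :
    sliceCoord I (sliceMap I z * q) = z * sliceCoord I q := by
  have h : I * (I * q) = -q := by rw [← mul_assoc, ← pow_two, hI, neg_one_mul]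
  have h1 : sliceMap I z * q = z.re • q + z.im • (I * q) := by
    simp [sliceMap, add_mul, Quaternion.coe_mul_eq_smul]
  have h2 : I * (sliceMap I z * q) = z.re • (I * q) - z.im • q := by
    rw [h1, mul_add, mul_smul_comm, mul_smul_comm, h, smul_neg, sub_eq_add_neg]
  rw [sliceCoord_apply, sliceCoord_apply, h2, h1]
  apply Complex.ext <;> simp <;> ring

/-- The standard basis `1, i, j, k` of the quaternions. -/
def stdBasis : Fin 4 → ℍ := ![ofComponents 1 0 0 0, ofComponents 0 1 0 0, ofComponents 0 0 1 0,
  ofComponents 0 0 0 1]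

theorem sum_re_mul_stdBasis (q : ℍ) : ∑ k, (q * stdBasis k).re • star (stdBasis k) = q := by
  ext <;> simp [Fin.sum_univ_four, stdBasis]

theorem sum_re_mul_stdBasis_sq (q : ℍ) : ∑ k, (q * stdBasis k).re ^ 2 = ‖q‖ ^ 2 := by
  rw [pow_two ‖q‖, ← Quaternion.normSq_eq_norm_mul_self, Quaternion.normSq_def']
  simp [Fin.sum_univ_four, stdBasis]

/-- Four coordinates on a space of complex dimension two: the real parts and the `I`-parts each
reconstruct `q`, hence the factor `1/2`. The redundancy avoids choosing a unit orthogonal to `I`. -/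
theorem sum_sliceMap_sliceCoord (hI : I ^ 2 = -1) (q : ℍ) :
    (1 / 2 : ℝ) • ∑ k, sliceMap I (sliceCoord I (q * stdBasis k)) * star (stdBasis k) = q := by
  have h : ∀ k, sliceMap I (sliceCoord I (q * stdBasis k)) * star (stdBasis k)
      = (q * stdBasis k).re • star (stdBasis k)
        - I * ((I * q * stdBasis k).re • star (stdBasis k)) := by
    intro k
    rw [sliceMap, sliceCoord_apply, add_mul, Quaternion.coe_mul_eq_smul, mul_assoc I q,
      mul_smul_comm, Quaternion.coe_mul_eq_smul, smul_mul_assoc, neg_smul, sub_eq_add_neg]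
  simp_rw [h, Finset.sum_sub_distrib, ← Finset.mul_sum, sum_re_mul_stdBasis]
  rw [← mul_assoc, ← pow_two, hI, neg_one_mul, sub_neg_eq_add, ← two_smul ℝ q, smul_smul]
  norm_num

theorem sum_norm_sliceCoord_sq (hI : I ^ 2 = -1) (q : ℍ) :
    ∑ k, ‖sliceCoord I (q * stdBasis k)‖ ^ 2 = 2 * ‖q‖ ^ 2 := by
  have h : ∀ k, ‖sliceCoord I (q * stdBasis k)‖ ^ 2
      = (q * stdBasis k).re ^ 2 + (I * q * stdBasis k).re ^ 2 := by
    intro k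
    rw [← Complex.normSq_eq_norm_sq, Complex.normSq_apply, sliceCoord_apply, mul_assoc]
    ring
  simp_rw [h, Finset.sum_add_distrib, sum_re_mul_stdBasis_sq, norm_mul,
    norm_eq_one_of_sq_eq_neg_one hI]
  ring

theorem eq_zero_of_sliceCoord_eq_zero (hI : I ^ 2 = -1) {q : ℍ}
    (h : ∀ k, sliceCoord I (q * stdBasis k) = 0) : q = 0 := by
  have := sum_norm_sliceCoord_sq hI q
  simp only [h, norm_zero] at this
  simpa using this.symm

end Slice

/-! ### The quaternionic kernel and regularity of the transform -/

section Kernel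

variable {ν : ℝ}

/-- The exponential commutes with the continuous algebra homomorphism `sliceHom J`. -/
theorem kernel_sliceMap (ν : ℝ) {J : ℍ} (hJ : J ^ 2 = -1) (z : ℂ) (x : ℝ) :
    kernel ν (sliceMap J z) x = sliceMap J (kernelC ν z x) := by
  have hc : Continuous (sliceHom J hJ) := by
    simpa only [funext (sliceHom_apply hJ)] using continuous_sliceMap J
  rw [kernelC, sliceMap_mul hJ, sliceMap_ofReal, Quaternion.coe_mul_eq_smul, kernel,
    ← sliceHom_apply hJ (Complex.exp _), Complex.exp_eq_exp_ℂ,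
    NormedSpace.map_exp (sliceHom J hJ) hc]
  congr 2
  have hr : ∀ r : ℝ, sliceHom J hJ r = r := fun r => by rw [sliceHom_apply, sliceMap_ofReal]
  have e : -((ν : ℂ) / 2) * (z ^ 2 + (x : ℂ) ^ 2) + ν * √2 * (z * x)
      = (((-(ν / 2) : ℝ)) : ℂ) * (z ^ 2 + (x : ℂ) ^ 2) + ((ν * √2 : ℝ) : ℂ) * (z * x) := by
    push_cast; ring
  rw [e]
  simp only [map_add, map_mul, map_pow, hr, sliceHom_apply, Quaternion.coe_mul_eq_smul]

/-- The part of the exponent in `x²` is real, hence central, so its exponential splits off and damps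
`p`. -/
theorem kernel_mul_eq (ν : ℝ) (q p : ℍ) (x : ℝ) :
    kernel ν q x * p = (ν / Real.pi) ^ (3 / 4 : ℝ) •
      (NormedSpace.exp (-(ν / 2) • q ^ 2 + (ν * √2 * (x : ℝ)) • q) *
        (Real.exp (-(ν / 2) * ‖x‖ ^ 2) • p)) := by
  have e : -(ν / 2) • (q ^ 2 + (x : ℍ) ^ 2) + (ν * √2) • (q * (x : ℍ))
      = (-(ν / 2) • q ^ 2 + (ν * √2 * x) • q) + ((-(ν / 2) * ‖x‖ ^ 2 : ℝ) : ℍ) := by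
    rw [Quaternion.mul_coe_eq_smul, smul_smul, smul_add, ← Quaternion.coe_pow,
      ← Quaternion.coe_smul, smul_eq_mul, Real.norm_eq_abs, sq_abs]
    abel
  let : NormedAlgebra ℚ ℍ := NormedAlgebra.restrictScalars ℚ ℝ ℍ
  rw [kernel, e, NormedSpace.exp_add_of_commute (Quaternion.coe_commute _ _).symm,
    Quaternion.exp_coe, Quaternion.mul_coe_eq_smul, ← Real.exp_eq_exp_ℝ]
  simp only [smul_mul_assoc, mul_smul_comm]

theorem aestronglyMeasurable_gaussian_smul {ψ : ℝ → ℍ} (hψ : MemLp ψ 2) :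
    AEStronglyMeasurable fun x : ℝ => Real.exp (-(ν / 2) * ‖x‖ ^ 2) • ψ x :=
  (by fun_prop : Continuous fun x : ℝ =>
    Real.exp (-(ν / 2) * ‖x‖ ^ 2)).aestronglyMeasurable.smul hψ.1

theorem integrable_kernel_mul (hν : 0 < ν) {ψ : ℝ → ℍ} (hψ : MemLp ψ 2) (q : ℍ) :
    Integrable fun x : ℝ => kernel ν q x * ψ x := by
  simp only [kernel_mul_eq]
  exact (integrable_exp_quadratic_mul (𝕜 := ℝ) _ _ (aestronglyMeasurable_gaussian_smul hψ)
    (integrable_exp_mul_norm_gaussian_smul (half_pos hν) hψ) q).smul ((ν / Real.pi) ^ (3 / 4 : ℝ))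

theorem differentiable_transform (hν : 0 < ν) {ψ : ℝ → ℍ} (hψ : MemLp ψ 2) :
    Differentiable ℝ (transform ν ψ) := by
  have h := differentiable_integral_exp_quadratic_mul (𝕜 := ℝ) (-(ν / 2)) (ν * √2)
    (aestronglyMeasurable_gaussian_smul hψ)
    (integrable_exp_mul_norm_gaussian_smul (half_pos hν) hψ)
  have e : transform ν ψ = fun q => (ν / Real.pi) ^ (3 / 4 : ℝ) • ∫ x : ℝ,
      NormedSpace.exp (-(ν / 2) • q ^ 2 + (ν * √2 * (x : ℝ)) • q) *
        (Real.exp (-(ν / 2) * ‖x‖ ^ 2) • ψ x) := by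
    funext q
    simp only [transform, kernel_mul_eq]
    rw [integral_smul]
  rw [e]
  exact h.const_smul ((ν / Real.pi) ^ (3 / 4 : ℝ))

/-- The coordinate of `q e` on the slice `ℂ_J`, as a real-linear function of `q`. -/
def mulSliceCoord (J e : ℍ) : ℍ →L[ℝ] ℂ :=
  (sliceCoord J).comp ((ContinuousLinearMap.mul ℝ ℍ).flip e)

theorem mulSliceCoord_apply (J e q : ℍ) : mulSliceCoord J e q = sliceCoord J (q * e) := rfl

theorem memLp_sliceCoord {α : Type*} [MeasurableSpace α] {μ : Measure α} {ψ : α → ℍ}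
    (hψ : MemLp ψ 2 μ) (J e : ℍ) : MemLp (fun x => sliceCoord J (ψ x * e)) 2 μ :=
  (mulSliceCoord J e).comp_memLp' hψ

theorem sliceCoord_transform (hν : 0 < ν) {ψ : ℝ → ℍ} (hψ : MemLp ψ 2) {J : ℍ} (hJ : J ^ 2 = -1)
    (e : ℍ) (z : ℂ) : sliceCoord J (transform ν ψ (sliceMap J z) * e)
      = transformC ν (fun x => sliceCoord J (ψ x * e)) z := by
  rw [← mulSliceCoord_apply, transform,
    ← ContinuousLinearMap.integral_comp_comm _ (integrable_kernel_mul hν hψ _), transformC]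
  congr 1; ext1 x
  rw [mulSliceCoord_apply, kernel_sliceMap ν hJ, mul_assoc, sliceCoord_sliceMap_mul hJ]

theorem hasDerivAt_complexMk_re (x y : ℝ) : HasDerivAt (fun s : ℝ => (⟨s, y⟩ : ℂ)) 1 x := by
  have : (fun s : ℝ => (⟨s, y⟩ : ℂ)) = fun s : ℝ => (s : ℂ) + y * Complex.I := by
    funext s; apply Complex.ext <;> simp
  rw [this]
  exact Complex.ofRealCLM.hasDerivAt.add_const _

theorem hasDerivAt_complexMk_im (x y : ℝ) :
    HasDerivAt (fun t : ℝ => (⟨x, t⟩ : ℂ)) Complex.I y := by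
  have : (fun t : ℝ => (⟨x, t⟩ : ℂ)) = fun t : ℝ => (x : ℂ) + t * Complex.I := by
    funext s; apply Complex.ext <;> simp
  rw [this]
  simpa using (Complex.ofRealCLM.hasDerivAt.mul_const Complex.I).const_add (x : ℂ)

/-- A function on a slice whose coordinates are entire is `C¹` and satisfies the Cauchy-Riemann
equation. -/
theorem contDiff_and_dbar_of_sliceCoord {J : ℍ} (hJ : J ^ 2 = -1) {F : ℂ → ℍ}
    (hF : ∀ k, Differentiable ℂ fun z => sliceCoord J (F z * stdBasis k)) :
    ContDiff ℝ 1 F ∧ ∀ x y : ℝ, deriv (fun s : ℝ => F ⟨s, y⟩) x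
      + J * deriv (fun t : ℝ => F ⟨x, t⟩) y = 0 := by
  have e : F = fun z => (1 / 2 : ℝ) • ∑ k, sliceCLM J (sliceCoord J (F z * stdBasis k)) *
      star (stdBasis k) := by
    funext z
    simp only [sliceCLM_apply]
    exact (sum_sliceMap_sliceCoord hJ _).symm
  refine ⟨?_, fun x y => ?_⟩
  · rw [e]
    refine ContDiff.const_smul _ (ContDiff.sum fun k _ => ContDiff.mul ?_ contDiff_const)
    have h : ContDiff ℂ 1 fun z => sliceCoord J (F z * stdBasis k) := (hF k).contDiff
    exact (sliceCLM J).contDiff.comp (h.restrict_scalars ℝ)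
  · have hx := hasDerivAt_complexMk_re x y
    have hy := hasDerivAt_complexMk_im x y
    set D : Fin 4 → ℂ := fun k => deriv (fun z => sliceCoord J (F z * stdBasis k)) ⟨x, y⟩
    have hD : ∀ k, HasDerivAt (fun z => sliceCoord J (F z * stdBasis k)) (D k) ⟨x, y⟩ :=
      fun k => (hF k _).hasDerivAt
    -- The chain rule along a curve through the point, applied with velocity `1` and with velocity
    -- `i`; the two results cancel because `J² = -1`.
    have gen : ∀ (c : ℝ → ℂ) (c' : ℂ) (t : ℝ), HasDerivAt c c' t → c t = ⟨x, y⟩ →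
        HasDerivAt (fun s => F (c s))
          ((1 / 2 : ℝ) • ∑ k, sliceCLM J (D k * c') * star (stdBasis k)) t := by
      intro c c' t hc ht
      have h := fun k => ((sliceCLM J).hasFDerivAt.comp_hasDerivAt t
        (((ht.symm ▸ hD k : HasDerivAt (fun z => sliceCoord J (F z * stdBasis k))
          (D k) (c t)).comp t hc))).mul_const (star (stdBasis k))
      rw [e]
      exact (HasDerivAt.fun_sum fun k _ => h k).const_smul (1 / 2 : ℝ)
    rw [(gen _ _ _ hx rfl).deriv, (gen _ _ _ hy rfl).deriv, mul_smul_comm, ← smul_add,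
      Finset.mul_sum, ← Finset.sum_add_distrib]
    have : ∀ k, sliceCLM J (D k * 1) * star (stdBasis k) +
        J * (sliceCLM J (D k * Complex.I) * star (stdBasis k)) = 0 := by
      intro k
      rw [sliceCLM_apply, sliceCLM_apply, mul_comm (D k) Complex.I,
        sliceMap_mul hJ Complex.I, sliceMap_I, ← mul_assoc, ← mul_assoc, ← pow_two, hJ, mul_one]
      simp
    rw [Finset.sum_eq_zero fun k _ => this k, smul_zero]

theorem sliceRegular_transform (hν : 0 < ν) {ψ : ℝ → ℍ} (hψ : MemLp ψ 2) :
    SliceRegular (transform ν ψ) := by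
  have hF : ∀ J : ℍ, J ^ 2 = -1 → ∀ k, Differentiable ℂ fun z =>
      sliceCoord J (transform ν ψ (sliceMap J z) * stdBasis k) := by
    intro J hJ k
    simp only [sliceCoord_transform hν hψ hJ]
    exact differentiable_transformC hν (memLp_sliceCoord hψ _ _)
  refine ⟨differentiable_transform hν hψ, fun J hJ => ?_, fun J hJ x y => ?_⟩
  · exact (contDiff_and_dbar_of_sliceCoord hJ (hF J hJ)).1
  · rw [(contDiff_and_dbar_of_sliceCoord hJ (hF J hJ)).2 x y, smul_zero]

end Kernel

/-! ### The transform as an isometry into `L²(ℂ; ℍ)` -/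

section Isometry

variable {ν : ℝ} {I : ℍ}

/-- The restriction of `f` to a slice, multiplied by the square root of the Gaussian weight. -/
def weighted (ν : ℝ) (I : ℍ) (f : ℍ → ℍ) (z : ℂ) : ℍ :=
  Real.exp (-(ν / 2) * ‖z‖ ^ 2) • f (sliceMap I z)

theorem exp_neg_mul_norm_sq_eq (ν : ℝ) (z : ℂ) : Real.exp (-ν * ‖z‖ ^ 2)
    = Real.exp (-(ν / 2) * ‖z‖ ^ 2) * Real.exp (-(ν / 2) * ‖z‖ ^ 2) := by
  rw [← Real.exp_add]; congr 1; ring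

theorem norm_weighted_sq (hI : I ^ 2 = -1) (f : ℍ → ℍ) (z : ℂ) :
    ‖weighted ν I f z‖ ^ 2 = fockDensity ν I f z := by
  rw [weighted, fockDensity, norm_smul, norm_sliceMap hI, exp_neg_mul_norm_sq_eq ν,
    Real.norm_of_nonneg (Real.exp_pos _).le]
  ring

theorem continuous_weighted {f : ℍ → ℍ} (hf : SliceRegular f) : Continuous (weighted ν I f) := by
  have := hf.differentiable.continuous.comp (continuous_sliceMap I)
  exact (by fun_prop : Continuous fun z : ℂ => Real.exp (-(ν / 2) * ‖z‖ ^ 2)).smul this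

theorem memLp_weighted (hI : I ^ 2 = -1) {f : ℍ → ℍ} (hf : f ∈ fock ν I) :
    MemLp (weighted ν I f) 2 := by
  rw [memLp_two_iff_integrable_sq_norm (continuous_weighted hf.1).aestronglyMeasurable]
  simp only [norm_weighted_sq hI]
  exact hf.2

theorem mem_fock_of_memLp_weighted (hI : I ^ 2 = -1) {f : ℍ → ℍ} (hf : SliceRegular f)
    (h : MemLp (weighted ν I f) 2) : f ∈ fock ν I := by
  rw [memLp_two_iff_integrable_sq_norm (continuous_weighted hf).aestronglyMeasurable] at h
  simp only [norm_weighted_sq hI] at h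
  exact ⟨hf, h⟩

theorem sum_enorm_sliceCoord_sq (hI : I ^ 2 = -1) (q : ℍ) :
    ∑ k, ‖sliceCoord I (q * stdBasis k)‖ₑ ^ 2 = 2 * ‖q‖ₑ ^ 2 := by
  have h := congrArg ENNReal.ofReal (sum_norm_sliceCoord_sq hI q)
  rw [ENNReal.ofReal_sum_of_nonneg (fun _ _ => by positivity), ENNReal.ofReal_mul (by norm_num)]
    at h
  simpa [ENNReal.ofReal_pow, ofReal_norm] using h

/-- Twice each side is a sum over the four coordinates, and the complex isometry applies to each. -/
theorem lintegral_enorm_weighted_transform_sq (hν : 0 < ν) (hI : I ^ 2 = -1) {ψ : ℝ → ℍ}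
    (hψ : MemLp ψ 2) :
    ∫⁻ z, ‖weighted ν I (transform ν ψ) z‖ₑ ^ 2 = ∫⁻ x, ‖ψ x‖ₑ ^ 2 := by
  have h2 : (2 : ENNReal) ≠ 0 := by norm_num
  refine (ENNReal.mul_right_inj h2 (by norm_num)).1 ?_
  rw [← lintegral_const_mul' _ _ (by norm_num), ← lintegral_const_mul' _ _ (by norm_num)]
  simp_rw [← sum_enorm_sliceCoord_sq hI]
  have hc := fun k => memLp_sliceCoord hψ I (stdBasis k)
  have hw := continuous_weighted (ν := ν) (I := I) (sliceRegular_transform hν hψ)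
  rw [lintegral_finsetSum' _ fun k _ => (hc k).1.enorm.pow_const 2, lintegral_finsetSum']
  · refine Finset.sum_congr rfl fun k _ => ?_
    rw [← lintegral_norm_transformC_sq hν (hc k)]
    refine lintegral_congr fun z => ?_
    rw [weighted, smul_mul_assoc, map_smul, sliceCoord_transform hν hψ hI, ← ofReal_norm,
      ← ENNReal.ofReal_pow (norm_nonneg _), norm_smul, exp_neg_mul_norm_sq_eq ν,
      Real.norm_of_nonneg (Real.exp_pos _).le]
    congr 1; ring
  · intro k _
    have : Continuous fun z => sliceCoord I (weighted ν I (transform ν ψ) z * stdBasis k) :=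
      (mulSliceCoord I (stdBasis k)).continuous.comp hw
    exact this.enorm.measurable.aemeasurable.pow_const 2

theorem eLpNorm_two_sq {α F : Type*} [MeasurableSpace α] {μ : Measure α} [NormedAddCommGroup F]
    (f : α → F) : eLpNorm f 2 μ ^ 2 = ∫⁻ x, ‖f x‖ₑ ^ 2 ∂μ := by
  simpa using eLpNorm_nnreal_pow_eq_lintegral (f := f) (μ := μ) (p := 2) (by norm_num)

theorem eLpNorm_weighted_transform (hν : 0 < ν) (hI : I ^ 2 = -1) {ψ : ℝ → ℍ}
    (hψ : MemLp ψ 2) :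
    eLpNorm (weighted ν I (transform ν ψ)) 2 volume = eLpNorm ψ 2 volume := by
  have h := lintegral_enorm_weighted_transform_sq hν hI hψ
  rw [← eLpNorm_two_sq, ← eLpNorm_two_sq] at h
  exact (ENNReal.pow_right_strictMono two_ne_zero).injective h

theorem memLp_weighted_transform (hν : 0 < ν) (hI : I ^ 2 = -1) {ψ : ℝ → ℍ} (hψ : MemLp ψ 2) :
    MemLp (weighted ν I (transform ν ψ)) 2 :=
  ⟨(continuous_weighted (sliceRegular_transform hν hψ)).aestronglyMeasurable,
    (eLpNorm_weighted_transform hν hI hψ).trans_lt hψ.2⟩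

theorem transform_mem_fock (hν : 0 < ν) (hI : I ^ 2 = -1) {ψ : ℝ → ℍ} (hψ : MemLp ψ 2) :
    transform ν ψ ∈ fock ν I :=
  mem_fock_of_memLp_weighted hI (sliceRegular_transform hν hψ) (memLp_weighted_transform hν hI hψ)

theorem transform_congr_ae {φ ψ : ℝ → ℍ} (h : φ =ᵐ[volume] ψ) : transform ν φ = transform ν ψ := by
  funext q
  exact integral_congr_ae (h.mono fun x hx => by simp only [hx])

theorem transform_add (hν : 0 < ν) {φ ψ : ℝ → ℍ} (hφ : MemLp φ 2) (hψ : MemLp ψ 2) :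
    transform ν (φ + ψ) = transform ν φ + transform ν ψ := by
  funext q
  simp only [transform, Pi.add_apply, mul_add]
  exact integral_add (integrable_kernel_mul hν hφ q) (integrable_kernel_mul hν hψ q)

theorem transform_op_smul (hν : 0 < ν) {ψ : ℝ → ℍ} (hψ : MemLp ψ 2) (c : ℍᵐᵒᵖ) :
    transform ν (c • ψ) = c • transform ν ψ := by
  funext q
  simp only [transform, Pi.smul_apply, MulOpposite.smul_eq_mul_unop, ← mul_assoc]
  exact ((ContinuousLinearMap.mul ℝ ℍ).flip c.unop).integral_comp_comm
    (integrable_kernel_mul hν hψ q)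

/-- The Segal-Bargmann transform as a right-linear map into the Fock space. -/
def transformLinear (hν : 0 < ν) (hI : I ^ 2 = -1) : L2 →ₗ[ℍᵐᵒᵖ] fock ν I where
  toFun ψ := ⟨transform ν ψ, transform_mem_fock hν hI (Lp.memLp ψ)⟩
  map_add' φ ψ := Subtype.ext <| by
    rw [Submodule.coe_add, ← transform_add hν (Lp.memLp φ) (Lp.memLp ψ)]
    exact transform_congr_ae (Lp.coeFn_add φ ψ)
  map_smul' c ψ := Subtype.ext <| by
    rw [RingHom.id_apply, Submodule.coe_smul, ← transform_op_smul hν (Lp.memLp ψ)]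
    exact transform_congr_ae (Lp.coeFn_smul c ψ)

theorem coe_transformLinear (hν : 0 < ν) (hI : I ^ 2 = -1) (ψ : L2) :
    (transformLinear hν hI ψ : ℍ → ℍ) = transform ν ψ := rfl

theorem weighted_add (f g : ℍ → ℍ) :
    weighted ν I (f + g) = weighted ν I f + weighted ν I g := by
  funext z; simp [weighted]

theorem weighted_op_smul (c : ℍᵐᵒᵖ) (f : ℍ → ℍ) :
    weighted ν I (c • f) = c • weighted ν I f := by
  funext z; simp [weighted]

theorem op_coe_smul (r : ℝ) (q : ℍ) : MulOpposite.op (r : ℍ) • q = r • q := by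
  rw [MulOpposite.smul_eq_mul_unop, MulOpposite.unop_op, Quaternion.mul_coe_eq_smul]

/-- The embedding of the Fock space into `L²(ℂ; ℍ)`. -/
def fockToLp (ν : ℝ) (hI : I ^ 2 = -1) : fock ν I →ₗ[ℍᵐᵒᵖ] Lp ℍ 2 (volume : Measure ℂ) where
  toFun f := (memLp_weighted hI f.2).toLp
  map_add' f g := by
    rw [← MemLp.toLp_add]
    congr 1
    exact weighted_add _ _
  map_smul' c f := by
    rw [RingHom.id_apply, ← MemLp.toLp_const_smul]
    congr 1
    exact weighted_op_smul _ _

theorem coeFn_fockToLp (hI : I ^ 2 = -1) (f : fock ν I) :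
    fockToLp ν hI f =ᵐ[volume] weighted ν I f :=
  MemLp.coeFn_toLp (memLp_weighted hI f.2)

/-- Right multiplication by a real quaternion on `L²` is real scalar multiplication. -/
theorem op_coe_smul_Lp {α : Type*} [MeasurableSpace α] {μ : Measure α} (r : ℝ) (f : Lp ℍ 2 μ) :
    MulOpposite.op (r : ℍ) • f = r • f := by
  refine Lp.ext ?_
  filter_upwards [Lp.coeFn_smul (MulOpposite.op (r : ℍ)) f, Lp.coeFn_smul r f] with x h1 h2
  rw [h1, h2, Pi.smul_apply, Pi.smul_apply, op_coe_smul]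

/-- The Segal-Bargmann transform as a real-linear isometry into `L²(ℂ; ℍ)`. -/
def bargmann (hν : 0 < ν) (hI : I ^ 2 = -1) : L2 →ₗᵢ[ℝ] Lp ℍ 2 (volume : Measure ℂ) where
  toFun ψ := fockToLp ν hI (transformLinear hν hI ψ)
  map_add' φ ψ := by rw [map_add, map_add]
  map_smul' r ψ := by
    rw [← op_coe_smul_Lp, map_smul, map_smul, op_coe_smul_Lp, RingHom.id_apply]
  norm_map' ψ := by
    change ‖fockToLp ν hI (transformLinear hν hI ψ)‖ = ‖ψ‖
    rw [Lp.norm_def, Lp.norm_def, eLpNorm_congr_ae (coeFn_fockToLp hI _), coe_transformLinear,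
      eLpNorm_weighted_transform hν hI (Lp.memLp ψ)]

theorem bargmann_apply (hν : 0 < ν) (hI : I ^ 2 = -1) (ψ : L2) :
    bargmann hν hI ψ = fockToLp ν hI (transformLinear hν hI ψ) := rfl

end Isometry

/-! ### Holomorphy on slices and the identity principle -/

section Identity

theorem SliceRegular.differentiable_sliceCoord {f : ℍ → ℍ} (hf : SliceRegular f) {J : ℍ}
    (hJ : J ^ 2 = -1) (e : ℍ) :
    Differentiable ℂ fun z : ℂ => sliceCoord J (f (sliceMap J z) * e) := by
  intro z
  have hR : DifferentiableAt ℝ (fun z : ℂ => f (sliceMap J z)) z :=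
    (hf.contDiff_slice J hJ).differentiable (by norm_num) z
  have hR' := (mulSliceCoord J e).hasFDerivAt.comp z hR.hasFDerivAt
  refine differentiableAt_complex_iff_differentiableAt_real.2 ⟨hR'.differentiableAt, ?_⟩
  set D := fderiv ℝ (fun z : ℂ => f (sliceMap J z)) z
  have hx : HasDerivAt (fun s : ℝ => f (sliceMap J ⟨s, z.im⟩)) (D 1) z.re :=
    hR.hasFDerivAt.comp_hasDerivAt (f := fun s : ℝ => (⟨s, z.im⟩ : ℂ)) z.re
      (hasDerivAt_complexMk_re _ _)
  have hy : HasDerivAt (fun t : ℝ => f (sliceMap J ⟨z.re, t⟩)) (D Complex.I) z.im :=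
    hR.hasFDerivAt.comp_hasDerivAt (f := fun t : ℝ => (⟨z.re, t⟩ : ℂ)) z.im
      (hasDerivAt_complexMk_im _ _)
  have h := hf.dbar_eq_zero J hJ z.re z.im
  rw [hx.deriv, hy.deriv, smul_eq_zero_iff_right (by norm_num)] at h
  -- Left multiplication by `J` puts the equation into the form that the left `ℂ_J`-linear
  -- coordinates carry to the Cauchy-Riemann equation.
  have hJy : D Complex.I = J * D 1 := by
    have h1 : J * (D 1 + J * D Complex.I) = 0 := by rw [h, mul_zero]
    rw [mul_add, ← mul_assoc, ← pow_two, hJ, neg_one_mul, add_neg_eq_zero] at h1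
    exact h1.symm
  rw [show fderiv ℝ (fun z : ℂ => sliceCoord J (f (sliceMap J z) * e)) z
    = (mulSliceCoord J e).comp D from hR'.fderiv]
  simp only [ContinuousLinearMap.comp_apply, mulSliceCoord_apply, hJy]
  have := sliceCoord_sliceMap_mul hJ Complex.I (D 1 * e)
  rw [sliceMap_I] at this
  rw [mul_assoc, this, smul_eq_mul]

/-- The identity principle: a slice regular function vanishing on one slice vanishes. -/
theorem SliceRegular.eq_zero {f : ℍ → ℍ} (hf : SliceRegular f) {I : ℍ}
    (h : ∀ z, f (sliceMap I z) = 0) : f = 0 := by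
  funext q
  obtain ⟨J, hJ, z, rfl⟩ := exists_eq_sliceMap q
  refine eq_zero_of_sliceCoord_eq_zero hJ fun k => ?_
  have ha : AnalyticOnNhd ℂ (fun z : ℂ => sliceCoord J (f (sliceMap J z) * stdBasis k))
      Set.univ := fun w _ => (hf.differentiable_sliceCoord hJ _).analyticAt w
  -- The real axis lies in every slice and accumulates at `0`, so zeros on `ℂ_I` pass to `ℂ_J`.
  have hfr : ∃ᶠ w in 𝓝[≠] (0 : ℂ), sliceCoord J (f (sliceMap J w) * stdBasis k) = 0 := by
    have ht : Tendsto (fun r : ℝ => (r : ℂ)) (𝓝[≠] 0) (𝓝[≠] 0) := by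
      refine tendsto_nhdsWithin_iff.2 ⟨?_, ?_⟩
      · exact (Complex.continuous_ofReal.tendsto' 0 0 (by simp)).mono_left nhdsWithin_le_nhds
      · filter_upwards [self_mem_nhdsWithin] with r hr
        simpa using hr
    refine ht.frequently (Eventually.frequently (Eventually.of_forall fun r => ?_))
    rw [sliceMap_ofReal, ← sliceMap_ofReal I, h, zero_mul, map_zero]
  exact congrFun (ha.eq_of_frequently_eq (g := fun _ => 0) (fun _ _ => analyticAt_const) hfr) z

end Identity

/-! ### Surjectivity and the inverse as an adjoint -/

section Surjectivity

variable {ν : ℝ} {I : ℍ}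

theorem inner_mul_left_eq (a p q : ℍ) : inner ℝ (a * p) q = inner ℝ p (star a * q) := by
  rw [Quaternion.inner_def, Quaternion.inner_def, star_mul, star_star, ← mul_assoc,
    mul_assoc a p, ← sub_eq_zero]
  simp
  ring

/-- The function `x ↦ A(w; x) e` is square integrable. -/
theorem memLp_kernelC_mul (hν : 0 < ν) (I : ℍ) (w : ℂ) (e : ℍ) :
    MemLp (fun x => sliceMap I (kernelC ν w x) * e) 2 := by
  have h := (((ContinuousLinearMap.mul ℝ ℍ).flip e).comp (sliceCLM I)).comp_memLp'
    (memLp_kernelC hν w)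
  simpa [Function.comp_def, sliceCLM_apply] using h

theorem transform_kernelC_mul (hν : 0 < ν) (hI : I ^ 2 = -1) (w : ℂ) (e : ℍ) (z : ℂ) :
    transform ν (fun x => sliceMap I (kernelC ν w x) * e) (sliceMap I z)
      = sliceMap I ((ν / Real.pi) * Complex.exp (ν * (z * w))) * e := by
  have hint : Integrable fun x => kernelC ν z x * kernelC ν w x :=
    (memLp_kernelC hν z).integrable_mul (memLp_kernelC hν w)
  have h := (((ContinuousLinearMap.mul ℝ ℍ).flip e).comp (sliceCLM I)).integral_comp_comm hint
  rw [integral_kernelC_mul_kernelC hν] at h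
  simp only [ContinuousLinearMap.comp_apply, ContinuousLinearMap.flip_apply,
    ContinuousLinearMap.mul_apply', sliceCLM_apply, sliceMap_mul hI (kernelC _ _ _)] at h
  rw [← h, transform]
  simp only [kernel_sliceMap ν hI, mul_assoc]

/-- An element of the Fock space orthogonal to the range of the transform vanishes. -/
theorem eq_zero_of_adjoint_eq_zero (hν : 0 < ν) (hI : I ^ 2 = -1) (d : fock ν I)
    (h : ∀ φ : L2, inner ℝ (fockToLp ν hI d) (bargmann hν hI φ) = 0) : d = 0 := by
  have hpi := Real.pi_pos
  refine Subtype.ext (d.2.1.eq_zero (I := I) fun w => ?_)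
  set W := weighted ν I d with hW
  have hWm : MemLp W 2 := memLp_weighted hI d.2
  -- The conjugate of the weighted transform of `A(w̄; ·)`; thus `∫ K W` is the reproducing integral
  -- of `d` at `w`, up to a constant.
  set K : ℂ → ℍ := fun z => sliceMap I (Real.exp (-(ν / 2) * ‖z‖ ^ 2) *
      ((ν / Real.pi) * Complex.exp (ν * (starRingEnd ℂ z * w)))) with hK
  have hKm : MemLp K 2 := by
    refine ((memLp_exp_linear_sub_sq (V := ℂ) (half_pos hν) (ν * ‖w‖)).const_mul
      (ν / Real.pi)).mono ?_ (ae_of_all _ fun z => ?_)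
    · exact ((continuous_sliceMap I).comp (by fun_prop)).aestronglyMeasurable
    · rw [hK, norm_sliceMap hI, norm_mul, norm_mul, Complex.norm_real, Complex.norm_exp,
        Real.norm_of_nonneg (Real.exp_pos _).le, norm_mul,
        Real.norm_of_nonneg (Real.exp_pos (_ - _)).le, ← Complex.ofReal_div, Complex.norm_real,
        mul_left_comm, ← Real.exp_add]
      gcongr
      have h1 : (ν * (starRingEnd ℂ z * w)).re ≤ ν * (‖z‖ * ‖w‖) := by
        refine (Complex.re_le_norm _).trans ?_
        simp [abs_of_pos hν]
      linarith
  have hKW : Integrable fun z => K z * W z := hKm.integrable_mul hWm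
  have hzero : ∫ z, K z * W z = 0 := by
    -- Pairing with `e` moves `K` to the other side, and `star (K z) * e` is the weighted transform
    -- of `x ↦ A(w̄; x) e`, to which `d` is orthogonal by assumption.
    refine ext_inner_right ℝ fun e => ?_
    rw [inner_zero_left, real_inner_comm, ← integral_inner hKW]
    set φ := (memLp_kernelC_mul hν I (starRingEnd ℂ w) e).toLp with hφ
    rw [← h φ, L2.inner_def]
    refine integral_congr_ae ?_
    filter_upwards [coeFn_fockToLp hI d, coeFn_fockToLp hI (transformLinear hν hI φ)] with z h1 h2
    rw [bargmann_apply, h1, h2, coe_transformLinear, ← hW, weighted,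
      transform_congr_ae (memLp_kernelC_mul hν I (starRingEnd ℂ w) e).coeFn_toLp,
      transform_kernelC_mul hν hI, real_inner_comm, inner_mul_left_eq, hK, star_sliceMap hI,
      ← smul_mul_assoc, ← Quaternion.coe_mul_eq_smul, ← sliceMap_ofReal I, ← sliceMap_mul hI]
    congr 3
    simp only [map_mul, Complex.conj_ofReal, ← Complex.exp_conj, Complex.conj_conj, map_div₀]
  refine eq_zero_of_sliceCoord_eq_zero hI fun k => ?_
  have hd := d.2.1.differentiable_sliceCoord hI (stdBasis k)
  have hrep := integral_exp_mul_conj_mul_entire hν hd (by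
    have := memLp_sliceCoord hWm I (stdBasis k)
    simpa [hW, weighted] using this) w
  have h0 := (mulSliceCoord I (stdBasis k)).integral_comp_comm hKW
  rw [hzero, map_zero] at h0
  have e : ∀ z, mulSliceCoord I (stdBasis k) (K z * W z) = (ν / Real.pi : ℂ) *
      ((Real.exp (-ν * ‖z‖ ^ 2) : ℂ) * (Complex.exp (ν * (starRingEnd ℂ z * w)) *
        sliceCoord I ((d : ℍ → ℍ) (sliceMap I z) * stdBasis k))) := by
    intro z
    rw [mulSliceCoord_apply, hK, mul_assoc, sliceCoord_sliceMap_mul hI, hW, weighted,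
      smul_mul_assoc, map_smul, Complex.real_smul, exp_neg_mul_norm_sq_eq ν]
    push_cast
    ring
  simp_rw [e] at h0
  rw [integral_const_mul, hrep] at h0
  have h1 : (ν : ℂ) ≠ 0 := by exact_mod_cast hν.ne'
  have h2 : (Real.pi : ℂ) ≠ 0 := by exact_mod_cast hpi.ne'
  simpa [h1, h2] using h0

/-- The adjoint of the isometry `bargmann`. -/
def coBargmann (hν : 0 < ν) (hI : I ^ 2 = -1) : Lp ℍ 2 (volume : Measure ℂ) →L[ℝ] L2 :=
  ContinuousLinearMap.adjoint (bargmann hν hI).toContinuousLinearMap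

theorem inner_coBargmann (hν : 0 < ν) (hI : I ^ 2 = -1) (g : Lp ℍ 2 (volume : Measure ℂ))
    (φ : L2) : inner ℝ (coBargmann hν hI g) φ = inner ℝ g (bargmann hν hI φ) :=
  ContinuousLinearMap.adjoint_inner_left _ _ _

theorem coBargmann_bargmann (hν : 0 < ν) (hI : I ^ 2 = -1) (ψ : L2) :
    coBargmann hν hI (bargmann hν hI ψ) = ψ := by
  refine ext_inner_right ℝ fun φ => ?_
  rw [inner_coBargmann, LinearIsometry.inner_map_map]

theorem norm_coBargmann_le (hν : 0 < ν) (hI : I ^ 2 = -1) (g : Lp ℍ 2 (volume : Measure ℂ)) :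
    ‖coBargmann hν hI g‖ ≤ ‖g‖ := by
  have h := real_inner_self_eq_norm_sq (coBargmann hν hI g)
  rw [inner_coBargmann] at h
  have h2 := real_inner_le_norm g (bargmann hν hI (coBargmann hν hI g))
  rw [LinearIsometry.norm_map, h, pow_two] at h2
  rcases (norm_nonneg (coBargmann hν hI g)).eq_or_lt with h0 | h0
  · rw [← h0]; exact norm_nonneg _
  · exact le_of_mul_le_mul_right h2 h0

/-- The preimage of `f` is its adjoint image: the difference between `f` and the transform of that
image is orthogonal to the range. Completeness of the Fock space is not needed. -/
theorem bijective_transformLinear (hν : 0 < ν) (hI : I ^ 2 = -1) :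
    Function.Bijective (transformLinear (I := I) hν hI) := by
  refine ⟨fun φ ψ h => ?_, fun f => ?_⟩
  · refine (bargmann hν hI).injective ?_
    rw [bargmann_apply, bargmann_apply, h]
  · set ψ := coBargmann hν hI (fockToLp ν hI f)
    refine ⟨ψ, (sub_eq_zero.1 (eq_zero_of_adjoint_eq_zero hν hI _ fun φ => ?_)).symm⟩
    rw [map_sub, inner_sub_left, ← bargmann_apply, LinearIsometry.inner_map_map,
      ← inner_coBargmann, sub_self]

/-- The inverse of the Segal-Bargmann transform. -/
def inverseEquiv (hν : 0 < ν) (hI : I ^ 2 = -1) : fock ν I ≃ₗ[ℍᵐᵒᵖ] L2 :=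
  (LinearEquiv.ofBijective (transformLinear hν hI) (bijective_transformLinear hν hI)).symm

theorem inverseEquiv_symm_apply (hν : 0 < ν) (hI : I ^ 2 = -1) (ψ : L2) :
    (inverseEquiv hν hI).symm ψ = transformLinear hν hI ψ := rfl

theorem bargmann_inverseEquiv (hν : 0 < ν) (hI : I ^ 2 = -1) (f : fock ν I) :
    bargmann hν hI (inverseEquiv hν hI f) = fockToLp ν hI f := by
  rw [bargmann_apply, ← inverseEquiv_symm_apply, LinearEquiv.symm_apply_apply]

theorem inverseEquiv_eq_coBargmann (hν : 0 < ν) (hI : I ^ 2 = -1) (f : fock ν I) :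
    inverseEquiv hν hI f = coBargmann hν hI (fockToLp ν hI f) := by
  rw [← bargmann_inverseEquiv hν, coBargmann_bargmann]

end Surjectivity

variable {ν : ℝ} {I : ℍ}

/-! ### Preservation of the quaternionic inner product -/

section Unitary

theorem inner_star_mul_eq (p q e : ℍ) : inner ℝ (star p * q) e = inner ℝ q (p * e) := by
  rw [inner_mul_left_eq, star_star]

/-- The quaternionic inner product is determined by the real one. -/
theorem inner_integral_star_mul {α : Type*} [MeasurableSpace α] {μ : Measure α} (φ ψ : Lp ℍ 2 μ)
    (e : ℍ) : inner ℝ (∫ x, star (ψ x) * φ x ∂μ) e = inner ℝ φ (MulOpposite.op e • ψ) := by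
  have hi : Integrable (fun x => star (ψ x) * φ x) μ :=
    (Lp.memLp ψ).star.integrable_mul (Lp.memLp φ)
  rw [real_inner_comm, ← integral_inner hi, L2.inner_def]
  refine integral_congr_ae ?_
  filter_upwards [Lp.coeFn_smul (MulOpposite.op e) ψ] with x hx
  rw [hx, Pi.smul_apply, MulOpposite.smul_eq_mul_unop, MulOpposite.unop_op, real_inner_comm,
    inner_star_mul_eq]

theorem fockInner_eq_integral (hI : I ^ 2 = -1) (f g : fock ν I) :
    fockInner ν I f g = ∫ z, star (fockToLp ν hI g z) * fockToLp ν hI f z := by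
  refine integral_congr_ae ?_
  filter_upwards [coeFn_fockToLp hI f, coeFn_fockToLp hI g] with z h1 h2
  rw [h1, h2, weighted, weighted, norm_sliceMap hI, exp_neg_mul_norm_sq_eq,
    Quaternion.star_smul, smul_mul_smul_comm]

/-- Right linearity allows `g` to be replaced by its right multiples by `e`, so the real isometry
determines every real pairing of the quaternionic inner product. -/
theorem l2Inner_inverseEquiv (hν : 0 < ν) (hI : I ^ 2 = -1) (f g : fock ν I) :
    l2Inner (inverseEquiv hν hI f) (inverseEquiv hν hI g) = fockInner ν I f g := by
  refine ext_inner_right ℝ fun e => ?_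
  rw [fockInner_eq_integral hI, inner_integral_star_mul, l2Inner, inner_integral_star_mul,
    ← map_smul, ← map_smul, ← bargmann_inverseEquiv hν hI f,
    ← bargmann_inverseEquiv hν hI (MulOpposite.op e • g), LinearIsometry.inner_map_map]

theorem norm_Lp_two_sq {α F : Type*} [MeasurableSpace α] {μ : Measure α} [NormedAddCommGroup F]
    [InnerProductSpace ℝ F] (f : Lp F 2 μ) : ‖f‖ ^ 2 = ∫ x, ‖f x‖ ^ 2 ∂μ := by
  rw [← real_inner_self_eq_norm_sq, L2.inner_def]
  simp_rw [real_inner_self_eq_norm_sq]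

theorem norm_inverseEquiv_sq (hν : 0 < ν) (hI : I ^ 2 = -1) (f : fock ν I) :
    ‖inverseEquiv hν hI f‖ ^ 2 = ∫ z : ℂ, fockDensity ν I f z := by
  rw [← (bargmann hν hI).norm_map, bargmann_inverseEquiv, norm_Lp_two_sq]
  refine integral_congr_ae ?_
  filter_upwards [coeFn_fockToLp hI f] with z hz
  rw [hz, norm_weighted_sq hI]

end Unitary

/-! ### The integral formula for the inverse -/

section Inversion

/-- The integrand of the adjoint transform. -/
def dualIntegrand (ν : ℝ) (I : ℍ) (g : ℂ → ℍ) (x : ℝ) (z : ℂ) : ℍ :=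
  Real.exp (-(ν / 2) * ‖z‖ ^ 2) • (sliceMap I (kernelC ν (starRingEnd ℂ z) x) * g z)

/-- The Gaussian weight is split evenly: one half makes `f` square integrable on the slice, the
other stays with the kernel. -/
theorem smul_inverseIntegrand (hI : I ^ 2 = -1) (f : ℍ → ℍ) (x : ℝ) (z : ℂ) :
    (ν / Real.pi) ^ (3 / 4 : ℝ) • inverseIntegrand ν I f x z
      = dualIntegrand ν I (weighted ν I f) x z := by
  rw [dualIntegrand, ← kernel_sliceMap ν hI, kernel, ← star_sliceMap hI, inverseIntegrand,
    norm_sliceMap hI, exp_neg_mul_norm_sq_eq, weighted]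
  simp only [smul_mul_assoc, mul_smul_comm, smul_smul]
  congr 1; ring

theorem inverseIntegral_eq (hI : I ^ 2 = -1) (s : Set ℂ) (f : ℍ → ℍ) (x : ℝ) :
    inverseIntegral ν I s f x = ∫ z in s, dualIntegrand ν I (weighted ν I f) x z := by
  simp_rw [inverseIntegral, ← smul_inverseIntegrand hI]
  rw [integral_smul]

theorem integrable_inverseIntegrand_iff (hν : 0 < ν) (hI : I ^ 2 = -1) {μ : Measure ℂ} (f : ℍ → ℍ)
    (x : ℝ) : Integrable (inverseIntegrand ν I f x) μ ↔
      Integrable (dualIntegrand ν I (weighted ν I f) x) μ := by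
  have hpi := Real.pi_pos
  have hc : (ν / Real.pi) ^ (3 / 4 : ℝ) ≠ 0 := by positivity
  rw [← integrable_smul_iff hc]
  exact iff_of_eq (congrArg (Integrable · μ) (funext fun z => smul_inverseIntegrand hI f x z))

theorem continuous_dualIntegrand_factor (ν : ℝ) (I : ℍ) : Continuous fun p : ℂ × ℝ =>
    Real.exp (-(ν / 2) * ‖p.1‖ ^ 2) • sliceMap I (kernelC ν (starRingEnd ℂ p.1) p.2) := by
  have h1 : Continuous fun p : ℂ × ℝ => kernelC ν (starRingEnd ℂ p.1) p.2 := by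
    unfold kernelC; fun_prop
  have h2 : Continuous fun p : ℂ × ℝ => Real.exp (-(ν / 2) * ‖p.1‖ ^ 2) := by fun_prop
  exact h2.smul ((continuous_sliceMap I).comp h1)

theorem aestronglyMeasurable_dualIntegrand (I : ℍ) {g : ℂ → ℍ} {μ : Measure ℂ} [SFinite μ]
    (hg : AEStronglyMeasurable g μ) :
    AEStronglyMeasurable (fun p : ℂ × ℝ => dualIntegrand ν I g p.2 p.1) (μ.prod volume) := by
  have h := (continuous_dualIntegrand_factor ν I).aestronglyMeasurable
    (μ := μ.prod volume) |>.mul hg.comp_fst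
  exact h.congr (ae_of_all _ fun p => smul_mul_assoc _ _ _)

theorem aestronglyMeasurable_dualIntegrand_apply (I : ℍ) {g : ℂ → ℍ} {μ : Measure ℂ}
    (hg : AEStronglyMeasurable g μ) (x : ℝ) : AEStronglyMeasurable (dualIntegrand ν I g x) μ := by
  have h := ((continuous_dualIntegrand_factor ν I).comp
    (Continuous.prodMk_left x)).aestronglyMeasurable (μ := μ) |>.mul hg
  exact h.congr (ae_of_all _ fun p => smul_mul_assoc _ _ _)

theorem norm_dualIntegrand_le (hν : 0 < ν) (hI : I ^ 2 = -1) (g : ℂ → ℍ) {R : ℝ} {z : ℂ}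
    (hz : ‖z‖ ≤ R) (x : ℝ) : ‖dualIntegrand ν I g x z‖ ≤ ((ν / Real.pi) ^ (3 / 4 : ℝ) *
      Real.exp (ν / 2 * R ^ 2) * Real.exp (ν * √2 * R * ‖x‖ - ν / 2 * ‖x‖ ^ 2)) * ‖g z‖ := by
  rw [dualIntegrand, norm_smul, norm_mul, norm_sliceMap hI, Real.norm_of_nonneg (Real.exp_pos _).le]
  have h1 : Real.exp (-(ν / 2) * ‖z‖ ^ 2) ≤ 1 := by
    rw [Real.exp_le_one_iff]
    have : 0 ≤ ν / 2 * ‖z‖ ^ 2 := by positivity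
    linarith
  have h2 := norm_kernelC_le hν (z := starRingEnd ℂ z) (R := R) (by simpa using hz) x
  calc _ ≤ 1 * (‖kernelC ν (starRingEnd ℂ z) x‖ * ‖g z‖) := by gcongr
    _ ≤ _ := by rw [one_mul]; gcongr

theorem integrableOn_ball_of_memLp {g : ℂ → ℍ} (hg : MemLp g 2) (R : ℝ) :
    IntegrableOn g (Metric.ball 0 R) := by
  have : IsFiniteMeasure (volume.restrict (Metric.ball (0 : ℂ) R)) :=
    isFiniteMeasure_restrict.2 measure_ball_lt_top.ne
  exact (hg.restrict _).integrable (by norm_num)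

theorem integrableOn_dualIntegrand (hν : 0 < ν) (hI : I ^ 2 = -1) {g : ℂ → ℍ} (hg : MemLp g 2)
    (R x : ℝ) : IntegrableOn (dualIntegrand ν I g x) (Metric.ball 0 R) := by
  refine ((integrableOn_ball_of_memLp hg R).norm.const_mul ((ν / Real.pi) ^ (3 / 4 : ℝ) *
      Real.exp (ν / 2 * R ^ 2) * Real.exp (ν * √2 * R * ‖x‖ - ν / 2 * ‖x‖ ^ 2))).mono' ?_ ?_
  · exact aestronglyMeasurable_dualIntegrand_apply I hg.1.restrict x
  · filter_upwards [ae_restrict_mem measurableSet_ball] with z hz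
    exact norm_dualIntegrand_le hν hI g (mem_ball_zero_iff.1 hz).le x

theorem memLp_integral_dualIntegrand (hν : 0 < ν) (hI : I ^ 2 = -1) {g : ℂ → ℍ} (hg : MemLp g 2)
    (R : ℝ) : MemLp (fun x => ∫ z in Metric.ball 0 R, dualIntegrand ν I g x z) 2 := by
  refine ((memLp_exp_linear_sub_sq (V := ℝ) (half_pos hν) (ν * √2 * R)).const_mul
    ((ν / Real.pi) ^ (3 / 4 : ℝ) * Real.exp (ν / 2 * R ^ 2) *
      ∫ z in Metric.ball 0 R, ‖g z‖)).mono ?_ (ae_of_all _ fun x => ?_)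
  · have h := (aestronglyMeasurable_dualIntegrand (ν := ν) I
      (hg.1.restrict (s := Metric.ball 0 R))).prod_swap
    exact h.integral_prod_right'
  · refine (norm_integral_le_of_norm_le ((integrableOn_ball_of_memLp hg R).norm.const_mul
      ((ν / Real.pi) ^ (3 / 4 : ℝ) * Real.exp (ν / 2 * R ^ 2) *
        Real.exp (ν * √2 * R * ‖x‖ - ν / 2 * ‖x‖ ^ 2))) ?_).trans
      (le_trans (le_of_eq ?_) (le_abs_self _))
    · filter_upwards [ae_restrict_mem measurableSet_ball] with z hz
      exact norm_dualIntegrand_le hν hI g (mem_ball_zero_iff.1 hz).le x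
    · rw [integral_const_mul]; ring

/-- Left multiplication by `A(z̄; x)` has adjoint left multiplication by its conjugate `A(z; x)`. -/
theorem inner_dualIntegrand (hI : I ^ 2 = -1) (g : ℂ → ℍ) (x : ℝ) (z : ℂ) (p : ℍ) :
    inner ℝ (dualIntegrand ν I g x z) p = inner ℝ (g z)
      (Real.exp (-(ν / 2) * ‖z‖ ^ 2) • (kernel ν (sliceMap I z) x * p)) := by
  rw [dualIntegrand, real_inner_smul_left, real_inner_smul_right, inner_mul_left_eq,
    star_sliceMap hI, kernel_sliceMap ν hI]
  congr 4
  simp only [kernelC, map_mul, Complex.conj_ofReal, ← Complex.exp_conj, map_add, map_neg,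
    map_div₀, map_pow, Complex.conj_conj, map_ofNat]

/-- Over a disc, the adjoint of the transform is given by an integral. -/
theorem integral_inner_dualIntegrand (hν : 0 < ν) (hI : I ^ 2 = -1) {g : ℂ → ℍ} (hg : MemLp g 2)
    (R : ℝ) {φ : ℝ → ℍ} (hφ : MemLp φ 2) :
    ∫ x, inner ℝ (∫ z in Metric.ball 0 R, dualIntegrand ν I g x z) (φ x)
      = ∫ z in Metric.ball 0 R, inner ℝ (g z) (weighted ν I (transform ν φ) z) := by
  -- Fubini is justified on a disc: there `g` is integrable and the kernel has a majorant in `x`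
  -- alone that is square integrable, like `φ`.
  have hint : Integrable (fun p : ℂ × ℝ => (inner ℝ (dualIntegrand ν I g p.2 p.1) (φ p.2) : ℝ))
      ((volume.restrict (Metric.ball 0 R)).prod volume) := by
    have hb := (integrableOn_ball_of_memLp hg R).norm.mul_prod
      (((memLp_exp_linear_sub_sq (V := ℝ) (half_pos hν) (ν * √2 * R)).const_mul
        ((ν / Real.pi) ^ (3 / 4 : ℝ) * Real.exp (ν / 2 * R ^ 2))).integrable_mul hφ.norm)
    refine hb.mono' ?_ ?_
    · exact (aestronglyMeasurable_dualIntegrand I hg.1.restrict).inner hφ.1.comp_snd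
    · have : ∀ᵐ p : ℂ × ℝ ∂((volume.restrict (Metric.ball 0 R)).prod volume),
          p.1 ∈ Metric.ball (0 : ℂ) R :=
        Measure.quasiMeasurePreserving_fst.ae (ae_restrict_mem measurableSet_ball)
      filter_upwards [this] with p hp
      refine (norm_inner_le_norm _ _).trans ((mul_le_mul_of_nonneg_right
        (norm_dualIntegrand_le hν hI g (R := R) (mem_ball_zero_iff.1 hp).le p.2)
          (norm_nonneg _)).trans (le_of_eq ?_))
      simp only [Pi.mul_apply]
      ring
  have h1 : ∀ x, inner ℝ (∫ z in Metric.ball 0 R, dualIntegrand ν I g x z) (φ x)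
      = ∫ z in Metric.ball 0 R, inner ℝ (dualIntegrand ν I g x z) (φ x) := by
    intro x
    rw [real_inner_comm, ← integral_inner (integrableOn_dualIntegrand hν hI hg R x)]
    simp_rw [real_inner_comm]
  simp_rw [h1]
  rw [integral_integral_swap (f := fun (x : ℝ) (z : ℂ) =>
    (inner ℝ (dualIntegrand ν I g x z) (φ x) : ℝ)) hint.swap]
  refine integral_congr_ae (ae_of_all _ fun z => ?_)
  simp only [inner_dualIntegrand hI]
  have h2 := integral_inner (𝕜 := ℝ) ((integrable_kernel_mul hν hφ (sliceMap I z)).smul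
    (Real.exp (-(ν / 2) * ‖z‖ ^ 2))) (g z)
  simp only [Pi.smul_apply] at h2
  rw [h2, integral_smul]
  rfl

theorem toLp_integral_dualIntegrand (hν : 0 < ν) (hI : I ^ 2 = -1) {g : ℂ → ℍ} (hg : MemLp g 2)
    (R : ℝ) : (memLp_integral_dualIntegrand hν hI hg R).toLp
      = coBargmann hν hI ((hg.indicator (measurableSet_ball (x := 0) (ε := R))).toLp) := by
  refine ext_inner_right ℝ fun φ => ?_
  rw [inner_coBargmann, L2.inner_def, L2.inner_def]
  have e1 : ∫ x, inner ℝ ((memLp_integral_dualIntegrand hν hI hg R).toLp _ x) (φ x)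
      = ∫ x, inner ℝ (∫ z in Metric.ball 0 R, dualIntegrand ν I g x z) (φ x) := by
    refine integral_congr_ae ?_
    filter_upwards [(memLp_integral_dualIntegrand hν hI hg R).coeFn_toLp] with x hx
    rw [hx]
  rw [e1, integral_inner_dualIntegrand hν hI hg R (Lp.memLp φ),
    ← integral_indicator measurableSet_ball]
  refine integral_congr_ae ?_
  filter_upwards [(hg.indicator (measurableSet_ball (x := 0) (ε := R))).coeFn_toLp,
    coeFn_fockToLp hI (transformLinear hν hI φ)] with z h1 h2
  rw [h1, bargmann_apply, h2, coe_transformLinear]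
  by_cases hz : z ∈ Metric.ball (0 : ℂ) R
  · simp only [Set.indicator_of_mem hz]
  · simp only [Set.indicator_of_notMem hz, inner_zero_left]

/-- Truncations to discs converge in `L²`. -/
theorem tendsto_eLpNorm_indicator_ball_sub {g : ℂ → ℍ} (hm : StronglyMeasurable g)
    (hg : MemLp g 2) :
    Tendsto (fun R : ℝ => eLpNorm ((Metric.ball 0 R).indicator g - g) 2 volume) atTop (𝓝 0) := by
  have hsq : Tendsto (fun R : ℝ => ∫⁻ z, ‖((Metric.ball 0 R).indicator g - g) z‖ₑ ^ 2)
      atTop (𝓝 (∫⁻ _ : ℂ, 0)) := by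
    refine tendsto_lintegral_filter_of_dominated_convergence (fun z => ‖g z‖ₑ ^ 2) ?_ ?_ ?_ ?_
    · exact Eventually.of_forall fun R =>
        ((hm.indicator measurableSet_ball).sub hm).enorm.pow_const 2
    · refine Eventually.of_forall fun R => ae_of_all _ fun z => ?_
      by_cases hz : z ∈ Metric.ball (0 : ℂ) R <;> simp [hz]
    · rw [← eLpNorm_two_sq]
      exact (ENNReal.pow_lt_top hg.2).ne
    · refine ae_of_all _ fun z => tendsto_const_nhds.congr' ?_
      filter_upwards [eventually_gt_atTop ‖z‖] with R hR
      have : z ∈ Metric.ball (0 : ℂ) R := by simpa using hR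
      simp [this]
  simp_rw [← eLpNorm_two_sq, lintegral_zero] at hsq
  have h := ((ENNReal.continuous_rpow_const (y := 1 / 2)).tendsto 0).comp hsq
  have hr : ∀ a : ENNReal, (a ^ 2) ^ (1 / 2 : ℝ) = a := fun a => by
    rw [← ENNReal.rpow_natCast, ← ENNReal.rpow_mul]; norm_num
  simpa only [Function.comp_def, hr, ENNReal.zero_rpow_of_pos (by norm_num : (0 : ℝ) < 1 / 2)]
    using h

theorem memLp_inverseIntegral_ball (hν : 0 < ν) (hI : I ^ 2 = -1) (f : fock ν I) (R : ℝ) :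
    MemLp (inverseIntegral ν I (Metric.ball 0 R) f) 2 := by
  rw [funext (inverseIntegral_eq hI (Metric.ball 0 R) f)]
  exact memLp_integral_dualIntegrand hν hI (memLp_weighted hI f.2) R

/-- The difference is the adjoint applied to the truncation error, and the adjoint is a contraction.
-/
theorem eLpNorm_inverseIntegral_ball_sub_le (hν : 0 < ν) (hI : I ^ 2 = -1) (f : fock ν I)
    (R : ℝ) :
    eLpNorm (fun x => inverseIntegral ν I (Metric.ball 0 R) f x - inverseEquiv hν hI f x) 2 volume
      ≤ eLpNorm ((Metric.ball 0 R).indicator (weighted ν I f) - weighted ν I f) 2 volume := by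
  have hW := memLp_weighted hI f.2
  have hR := hW.indicator (measurableSet_ball (x := 0) (ε := R))
  set H := (memLp_integral_dualIntegrand hν hI hW R).toLp with hH
  have e1 : eLpNorm (fun x => inverseIntegral ν I (Metric.ball 0 R) f x
      - inverseEquiv hν hI f x) 2 volume = ‖H - inverseEquiv hν hI f‖ₑ := by
    rw [Lp.enorm_def]
    refine eLpNorm_congr_ae ?_
    filter_upwards [Lp.coeFn_sub H (inverseEquiv hν hI f),
      (memLp_integral_dualIntegrand hν hI hW R).coeFn_toLp] with x h1 h2
    rw [h1, Pi.sub_apply, hH, h2, inverseIntegral_eq hI]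
  have e2 : eLpNorm ((Metric.ball 0 R).indicator (weighted ν I f) - weighted ν I f) 2 volume
      = ‖hR.toLp - fockToLp ν hI f‖ₑ := by
    rw [Lp.enorm_def]
    refine eLpNorm_congr_ae ?_
    filter_upwards [Lp.coeFn_sub hR.toLp (fockToLp ν hI f), hR.coeFn_toLp,
      coeFn_fockToLp hI f] with z h1 h2 h3
    rw [h1, Pi.sub_apply, Pi.sub_apply, h2, h3]
  rw [e1, e2, hH, toLp_integral_dualIntegrand hν hI hW R, inverseEquiv_eq_coBargmann, ← map_sub,
    ← ofReal_norm, ← ofReal_norm]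
  exact ENNReal.ofReal_le_ofReal (norm_coBargmann_le hν hI _)

/-- The inversion integral converges in the mean. -/
theorem tendsto_inverseIntegral_ball (hν : 0 < ν) (hI : I ^ 2 = -1) (f : fock ν I) :
    Tendsto (fun R : ℝ => eLpNorm (fun x => inverseIntegral ν I (Metric.ball 0 R) f x
      - inverseEquiv hν hI f x) 2 volume) atTop (𝓝 0) :=
  tendsto_of_tendsto_of_tendsto_of_le_of_le tendsto_const_nhds
    (tendsto_eLpNorm_indicator_ball_sub
      (continuous_weighted f.2.1).stronglyMeasurable (memLp_weighted hI f.2)) (fun _ => zero_le)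
    (eLpNorm_inverseIntegral_ball_sub_le hν hI f)

/-- The inversion formula holds almost everywhere where the integral converges absolutely. -/
theorem inverseEquiv_ae_eq (hν : 0 < ν) (hI : I ^ 2 = -1) (f : fock ν I) :
    ∀ᵐ x : ℝ, Integrable (inverseIntegrand ν I f x) →
      inverseEquiv hν hI f x = inverseIntegral ν I Set.univ f x := by
  have hm : TendstoInMeasure volume (fun (R : ℝ) => inverseIntegral ν I (Metric.ball 0 R) f)
      atTop (inverseEquiv hν hI f) :=
    tendstoInMeasure_of_tendsto_eLpNorm (p := 2) (by norm_num)
      (fun R => (memLp_inverseIntegral_ball hν hI f R).1) (Lp.aestronglyMeasurable _)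
      (tendsto_inverseIntegral_ball hν hI f)
  -- Mean convergence gives almost everywhere convergence along some radii tending to infinity;
  -- where the full integral converges absolutely, the same disc integrals tend to it.
  obtain ⟨r, hr, hae⟩ := hm.exists_seq_tendsto_ae'
  filter_upwards [hae] with x hx hint
  refine tendsto_nhds_unique hx ?_
  have hc : AECover volume atTop fun n => Metric.ball (0 : ℂ) (r n) := aecover_ball hr
  have := (hc.integral_tendsto_of_countably_generated hint).const_smul
    ((ν / Real.pi) ^ (3 / 4 : ℝ))
  simpa only [inverseIntegral, setIntegral_univ] using this

/-- The inversion integral converges absolutely for functions of subcritical growth. -/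
theorem integrable_inverseIntegrand_of_growth (hν : 0 < ν) (hI : I ^ 2 = -1) (f : fock ν I)
    {C a : ℝ} (ha : a < ν / 2)
    (hf : ∀ z : ℂ, ‖(f : ℍ → ℍ) (sliceMap I z)‖ ≤ C * Real.exp (a * ‖z‖ ^ 2)) (x : ℝ) :
    Integrable (inverseIntegrand ν I f x) := by
  have hpi := Real.pi_pos
  have hC : 0 ≤ C := by simpa using (norm_nonneg _).trans (hf 0)
  rw [integrable_inverseIntegrand_iff hν hI]
  refine ((integrable_exp_linear_sub_sq (V := ℂ) (b := ν / 2 - a) (by linarith)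
    (ν * √2 * ‖x‖)).const_mul ((ν / Real.pi) ^ (3 / 4 : ℝ) * C)).mono'
    (aestronglyMeasurable_dualIntegrand_apply I (memLp_weighted hI f.2).1 x)
    (ae_of_all _ fun z => ?_)
  rw [dualIntegrand, norm_smul, norm_mul, norm_sliceMap hI,
    Real.norm_of_nonneg (Real.exp_pos _).le, weighted, norm_smul,
    Real.norm_of_nonneg (Real.exp_pos _).le]
  have h1 := norm_kernelC_le hν (z := starRingEnd ℂ z) (R := ‖z‖) (by simp) x
  calc _ ≤ Real.exp (-(ν / 2) * ‖z‖ ^ 2) * (((ν / Real.pi) ^ (3 / 4 : ℝ) *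
        Real.exp (ν / 2 * ‖z‖ ^ 2) * Real.exp (ν * √2 * ‖z‖ * ‖x‖ - ν / 2 * ‖x‖ ^ 2)) *
        (Real.exp (-(ν / 2) * ‖z‖ ^ 2) * (C * Real.exp (a * ‖z‖ ^ 2)))) := by
        gcongr
        exact hf z
    -- The coefficients of `‖z‖²` are `-ν/2` twice, `ν/2` from the kernel and `a` from `f`; their
    -- sum `a - ν/2` is negative.
    _ = (ν / Real.pi) ^ (3 / 4 : ℝ) * C * Real.exp (-(ν / 2) * ‖z‖ ^ 2 + ν / 2 * ‖z‖ ^ 2 +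
        (ν * √2 * ‖z‖ * ‖x‖ - ν / 2 * ‖x‖ ^ 2) + -(ν / 2) * ‖z‖ ^ 2 + a * ‖z‖ ^ 2) := by
        simp only [Real.exp_add]; ring
    _ ≤ _ := by
        gcongr
        have : 0 ≤ ν / 2 * ‖x‖ ^ 2 := by positivity
        linarith

end Inversion

end SegalBargmann

end

theorem mainTheorem3 (ν : ℝ) (hν : 0 < ν) (I : ℍ) (hI : I ^ 2 = -1) :
    -- the transform is given by an absolutely convergent integral on all of `L²(ℝ; ℍ)`
    (∀ (ψ : SegalBargmann.L2) (q : ℍ),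
      Integrable (fun x : ℝ => SegalBargmann.kernel ν q x * ψ x)) ∧
    ∃ U : SegalBargmann.fock ν I ≃ₗ[ℍᵐᵒᵖ] SegalBargmann.L2,
      -- `U` is the inverse of the transform
      (∀ ψ : SegalBargmann.L2, (U.symm ψ : ℍ → ℍ) = SegalBargmann.transform ν ψ) ∧
      -- `U` is unitary
      (∀ f g : SegalBargmann.fock ν I,
        SegalBargmann.l2Inner (U f) (U g) = SegalBargmann.fockInner ν I f g) ∧
      (∀ f : SegalBargmann.fock ν I,
        ‖U f‖ ^ 2 = ∫ z : ℂ, SegalBargmann.fockDensity ν I f z) ∧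
      -- the integral representation: in the mean over discs, for every `f`
      (∀ f : SegalBargmann.fock ν I,
        (∀ R : ℝ, (∀ x : ℝ, IntegrableOn (SegalBargmann.inverseIntegrand ν I f x)
            (Metric.ball 0 R)) ∧
          MemLp (SegalBargmann.inverseIntegral ν I (Metric.ball 0 R) f) 2 volume) ∧
        Tendsto (fun R : ℝ => eLpNorm
            (fun x => SegalBargmann.inverseIntegral ν I (Metric.ball 0 R) f x - U f x) 2 volume)
          atTop (𝓝 0)) ∧
      -- and pointwise, wherever the integral over the whole slice converges absolutely
      (∀ f : SegalBargmann.fock ν I, ∀ᵐ x : ℝ,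
        Integrable (SegalBargmann.inverseIntegrand ν I f x) →
          U f x = SegalBargmann.inverseIntegral ν I Set.univ f x) ∧
      -- which holds at all `x` under a subcritical growth bound
      (∀ f : SegalBargmann.fock ν I,
        (∃ C a : ℝ, a < ν / 2 ∧ ∀ z : ℂ,
          ‖(f : ℍ → ℍ) (SegalBargmann.sliceMap I z)‖ ≤ C * Real.exp (a * ‖z‖ ^ 2)) →
        ∀ x : ℝ, Integrable (SegalBargmann.inverseIntegrand ν I f x)) := by
  refine ⟨fun ψ q => SegalBargmann.integrable_kernel_mul hν (Lp.memLp ψ) q,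
    SegalBargmann.inverseEquiv hν hI, fun ψ => ?_, SegalBargmann.l2Inner_inverseEquiv hν hI,
    SegalBargmann.norm_inverseEquiv_sq hν hI, fun f => ⟨fun R => ⟨fun x => ?_, ?_⟩, ?_⟩,
    SegalBargmann.inverseEquiv_ae_eq hν hI, ?_⟩
  · rw [SegalBargmann.inverseEquiv_symm_apply, SegalBargmann.coe_transformLinear]
  · exact (SegalBargmann.integrable_inverseIntegrand_iff hν hI _ x).2
      (SegalBargmann.integrableOn_dualIntegrand hν hI (SegalBargmann.memLp_weighted hI f.2) R x)
  · exact SegalBargmann.memLp_inverseIntegral_ball hν hI f R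
  · exact SegalBargmann.tendsto_inverseIntegral_ball hν hI f
  · rintro f ⟨C, a, ha, hf⟩ x
    exact SegalBargmann.integrable_inverseIntegrand_of_growth hν hI f ha hf x
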